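/- Let $d\ge 1$, let $B_d$ be the open unit ball of $\mathbb C^d$ with closure $\overline B_d$ and boundary $S_d$, let $\langle z,w\rangle=\sum_j z_j\overline{w_j}$, and let $\sigma$ be the normalized Lebesgue measure on $S_d$. For a holomorphic function $b:B_d\to\mathbb D$ let $\mathcal H(b)$ be the de Branges--Rovnyak space, that is, the reproducing kernel Hilbert space of functions on $B_d$ with kernel $$k^b(z,w)=\frac{1-b(z)\overline{b(w)}}{(1-\langle z,w\rangle)^d},\qquad z,w\in B_d .$$ Let $\mu$ be a finite positive Borel measure on $\overline B_d$. A holomorphic function $f$ on $B_d$ is called $\mu$-admissible if the radial limit $f(\zeta)=\lim_{r\to1-}f(r\zeta)$ exists for $\mu$-almost every $\zeta\in S_d$; such an $f$ is thereby defined $\mu$-a.e. on $\overline B_d$, and $\|f\|_{L^2(\overline B_d,\mu)}\in[0,\infty]$. The measure $\mu$ is called a reverse Carleson measure for $\mathcal H(b)$, with constant $A>0$, if $$\|f\|_{\mathcal H(b)}\le A\,\|f\|_{L^2(\overline B_d,\mu)}\qquad\text{for all $\mu$-admissible } f\in\mathcal H(b).$$ Theorem. For every $d\ge1$ and $A>0$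 there is a constant $C>0$, depending only on $d$ and $A$, with the following property. Let $\mu$ be a finite positive Borel measure on $\overline B_d$, let $b:B_d\to\mathbb D$ be holomorphic and $\mu$-admissible, let $\mu$ be a reverse Carleson measure for $\mathcal H(b)$ with constant $A$, and let $g=d\mu|_{S_d}/d\sigma$ be the Radon--Nikodym derivative of (the absolutely continuous part of) $\mu|_{S_d}$ with respect to $\sigma$. Then for $\sigma$-almost every $\zeta\in S_d$ the radial limit $b(\zeta)$ exists and $$1-|b(\zeta)|^2\le C\,(1-|b(\zeta)|^2)^2\,g(\zeta).$$ -/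

import Mathlib

open Set Filter Topology MeasureTheory Metric
open scoped ENNReal NNReal ComplexConjugate

noncomputable section

/-- The complex Euclidean space `ℂ^d`. The form `⟨z, w⟩ = ∑ j, z j * conj (w j)`, linear in `z`,
is `inner ℂ w z` in Mathlib's convention. -/
abbrev CSpace (d : ℕ) : Type := EuclideanSpace ℂ (Fin d)

/-- The open unit ball of `ℂ^d`, as a type of points. -/
abbrev UnitBall (d : ℕ) : Type := ball (0 : CSpace d) 1

/-- The normalized Lebesgue measure `σ` on the unit sphere of `ℂ^d`, viewed as a Borel measure on
`ℂ^d` carried by the sphere: surface measure divided by its total mass. -/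
def sphereMeasure (d : ℕ) : Measure (CSpace d) :=
  ((Measure.addHaar : Measure (CSpace d)).toSphere univ)⁻¹ •
    ((Measure.addHaar : Measure (CSpace d)).toSphere).map Subtype.val

/-- `f` has the radial limit `l` at `ζ`: `f (r ζ) → l` as `r → 1-`. -/
def HasRadialLimit {d : ℕ} (f : CSpace d → ℂ) (ζ : CSpace d) (l : ℂ) : Prop :=
  Tendsto (fun r : ℝ => f ((r : ℂ) • ζ)) (𝓝[<] 1) (𝓝 l)

/-- The function on the closed ball defined by `f` inside the open ball and by the radial limits
of `f` on the unit sphere (with an arbitrary value where there is no radial limit). -/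
def boundaryExtension {d : ℕ} (f : CSpace d → ℂ) (z : CSpace d) : ℂ :=
  if ‖z‖ < 1 then f z else limUnder (𝓝[<] (1 : ℝ)) (fun r : ℝ => f ((r : ℂ) • z))

/-- `f` is `μ`-admissible: it is holomorphic in the unit ball and has radial limits `μ`-almost
everywhere on the unit sphere. -/
structure IsAdmissible {d : ℕ} (μ : Measure (CSpace d)) (f : CSpace d → ℂ) : Prop where
  holomorphic : DifferentiableOn ℂ f (ball 0 1)
  radialLimit : ∀ᵐ ζ ∂(μ.restrict (sphere 0 1)), ∃ l : ℂ, HasRadialLimit f ζ l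

/-- The kernel `(1 - b(z) conj (b(w))) / (1 - ⟨z, w⟩)^d` on the unit ball, as a matrix of
(scalar) operators on `ℂ`. -/
def dbrKernel {d : ℕ} (b : CSpace d → ℂ) : Matrix (UnitBall d) (UnitBall d) (ℂ →L[ℂ] ℂ) :=
  Matrix.of fun z w =>
    ((1 - b z * conj (b w)) / (1 - inner ℂ (w : CSpace d) (z : CSpace d)) ^ d) •
      ContinuousLinearMap.id ℂ ℂ

open scoped Classical ComplexOrder in
/-- The kernel `dbrKernel b` if it is positive semidefinite, and `0` otherwise. The first case holds
for every holomorphic `b` from the ball to the unit disk; the second case only makes the next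
definition total in `b`. -/
def dbrPosKernel {d : ℕ} (b : CSpace d → ℂ) : Matrix (UnitBall d) (UnitBall d) (ℂ →L[ℂ] ℂ) :=
  if (dbrKernel b).PosSemidef then dbrKernel b else 0

open scoped ComplexOrder in
instance dbrPosKernel_posSemidef {d : ℕ} (b : CSpace d → ℂ) :
    Fact (dbrPosKernel b).PosSemidef := by
  constructor
  unfold dbrPosKernel
  split_ifs with h
  · exact h
  · exact Matrix.PosSemidef.zero

/-- The de Branges–Rovnyak space `H(b)`: the reproducing kernel Hilbert space of functions on the
unit ball with kernel `(1 - b(z) conj (b(w))) / (1 - ⟨z, w⟩)^d`. -/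
abbrev DeBrangesRovnyak {d : ℕ} (b : CSpace d → ℂ) : Type :=
  RKHS.OfKernel (dbrPosKernel b)

open scoped Classical in
/-- An element of `H(b)` as a function on the unit ball (extended by zero to `ℂ^d`). -/
def DeBrangesRovnyak.toFun {d : ℕ} {b : CSpace d → ℂ} (f : DeBrangesRovnyak b)
    (z : CSpace d) : ℂ :=
  if h : z ∈ ball (0 : CSpace d) 1 then f (⟨z, h⟩ : UnitBall d) else 0

/-- The reverse Carleson inequality with constant `A`: `‖f‖_{H(b)} ≤ A ‖f‖_{L²(μ)}` for all
`μ`-admissible `f ∈ H(b)`, where `f` is defined on the sphere by its radial limits; the right-hand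
side may be infinite. -/
def IsReverseCarlesonWith {d : ℕ} (A : ℝ≥0) (b : CSpace d → ℂ) (μ : Measure (CSpace d)) : Prop :=
  ∀ f : DeBrangesRovnyak b, IsAdmissible μ f.toFun →
    ‖f‖ₑ ≤ (A : ℝ≥0∞) * eLpNorm (boundaryExtension f.toFun) 2 μ

end

/-! Write `B` for `b` inside the ball and for its radial limits on the sphere. Testing the reverse
Carleson inequality on the kernel function at `w` and multiplying by `(1 - |w|²)^d` turns the
squared kernel into the Poisson–Szegő kernel `P`: `1 - |b(w)|² ≤ A² ∫ |1 - B(z) conj b(w)|² P(w, z)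
dμ(z)` (`IsReverseCarlesonWith.one_sub_norm_sq_le`). Put `w = rζ`, integrate against a continuous `φ
: S → [0, 1]` and let `r → 1`. The left side tends to `∫ φ (1 - |B|²) dσ`.

On the right, Fubini leaves for each `z` an average over `ζ` against `P(rζ, z)`. For `z` inside the
ball its total mass tends to `0`, so interior mass of `μ` disappears. On the sphere `P(rζ, z) =
P(rz, ζ)` is an approximate identity. There `1 - u conj v = (1 - |u|²) + u conj (u - v)` gives `|1 -
B(z) conj b(rζ)|² ≤ 2 (1 - |B(z)|²)² + 2 |B(z) - b(rζ)|²`, and the average of the last term is the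
variance `dilatedVariance`. Its integral in `σ` tends to `0`: expand the square, use that `P` has
mass one in both variables and that the Poisson–Szegő integral of the dilate of `b` at `rz` is
`b(r²z)`; every term then has an explicit limit (`tendsto_integral_dilatedVariance`). Hence the
variance tends to `0` σ-almost everywhere along a subsequence, and so almost everywhere for the
absolutely continuous part of `μ`. The singular part lives on a σ-null set `N`, where the trivial
bound `4` suffices.

The limiting inequality (`IsReverseCarlesonWith.integral_le_boundaryWeight`) holds for all
continuous `φ`, hence compares two measures; discarding `N` and comparing densities gives the
theorem with `C = 2 A²`.

The supporting analysis is the Cauchy and Poisson formulas on the ball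
(`integral_div_one_sub_inner_pow`, `integral_mul_poissonSzego`), Fatou's theorem
(`ae_exists_hasRadialLimit`), and positivity of the kernel (`posSemidef_dbrKernel`), which
identifies the kernel functions and their norms. -/

/-! ### The normalized surface measure and its unitary invariance. -/

open scoped Pointwise in
theorem sphereMeasure_apply {d : ℕ} {s : Set (CSpace d)} (hs : MeasurableSet s) :
    sphereMeasure d s = ((Measure.addHaar : Measure (CSpace d)).toSphere univ)⁻¹ *
      (Module.finrank ℝ (CSpace d) *
        (Measure.addHaar : Measure (CSpace d)) (Ioo (0 : ℝ) 1 • (s ∩ sphere 0 1))) := by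
  rw [sphereMeasure, Measure.smul_apply, Measure.map_apply measurable_subtype_coe hs,
    Measure.toSphere_apply' _ (measurable_subtype_coe hs), Subtype.image_preimage_coe, smul_eq_mul,
    inter_comm]

theorem isProbabilityMeasure_sphereMeasure {d : ℕ} (hd : 1 ≤ d) :
    IsProbabilityMeasure (sphereMeasure d) := by
  have : Nonempty (Fin d) := ⟨⟨0, hd⟩⟩
  constructor
  rw [sphereMeasure, Measure.smul_apply, Measure.map_apply measurable_subtype_coe .univ,
    preimage_univ, smul_eq_mul]
  refine ENNReal.inv_mul_cancel ?_ (measure_ne_top _ _)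
  rw [Ne, Measure.measure_univ_eq_zero]
  exact Measure.toSphere_ne_zero _

theorem ae_sphereMeasure_norm_eq {d : ℕ} : ∀ᵐ ζ ∂(sphereMeasure d), ‖ζ‖ = 1 := by
  have : MeasurableSet {ζ : CSpace d | ‖ζ‖ = 1} :=
    (isClosed_eq continuous_norm continuous_const).measurableSet
  rw [ae_iff, show {a : CSpace d | ¬ ‖a‖ = 1} = {ζ : CSpace d | ‖ζ‖ = 1}ᶜ from rfl,
    sphereMeasure_apply this.compl]
  have : ({ζ : CSpace d | ‖ζ‖ = 1}ᶜ ∩ sphere 0 1) = ∅ := by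
    ext x; simp
  simp [this]

/-- The image measure is translation invariant, hence a multiple of the original; the unit ball is
mapped onto itself and has finite positive measure, so the factor is `1`. -/
theorem measurePreserving_addHaar_linearIsometryEquiv {d : ℕ}
    (T : CSpace d ≃ₗᵢ[ℂ] CSpace d) :
    MeasurePreserving T (Measure.addHaar : Measure (CSpace d)) Measure.addHaar := by
  refine ⟨T.continuous.measurable, ?_⟩
  have h := Measure.isAddLeftInvariant_eq_smul
    ((Measure.addHaar : Measure (CSpace d)).map (T.toContinuousLinearEquiv))
    (Measure.addHaar : Measure (CSpace d))
  set c := Measure.addHaarScalarFactor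
    ((Measure.addHaar : Measure (CSpace d)).map (T.toContinuousLinearEquiv))
    (Measure.addHaar : Measure (CSpace d)) with hc
  change Measure.map (T.toContinuousLinearEquiv) _ = _
  have hb : (Measure.addHaar : Measure (CSpace d)).map (T.toContinuousLinearEquiv) (ball 0 1) =
      Measure.addHaar (ball (0 : CSpace d) 1) := by
    rw [Measure.map_apply T.toContinuousLinearEquiv.continuous.measurable measurableSet_ball]
    congr 1
    ext x
    simp
  rw [h] at hb ⊢
  have h0 : (Measure.addHaar : Measure (CSpace d)) (ball (0 : CSpace d) 1) ≠ 0 :=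
    isOpen_ball.measure_ne_zero _ ⟨0, by simp⟩
  have h1 : (Measure.addHaar : Measure (CSpace d)) (ball (0 : CSpace d) 1) ≠ ∞ :=
    measure_ball_lt_top.ne
  have : (c : ℝ≥0∞) = 1 := by
    rw [Measure.smul_apply, ENNReal.smul_def, smul_eq_mul] at hb
    exact (ENNReal.mul_eq_right h0 h1).1 hb
  have : c = 1 := by exact_mod_cast this
  rw [this, one_smul]

-- Surface measure is the volume of the cone over a set, and a linear isometry maps cones to cones.
open scoped Pointwise in
theorem measurePreserving_sphereMeasure {d : ℕ} (T : CSpace d ≃ₗᵢ[ℂ] CSpace d) :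
    MeasurePreserving T (sphereMeasure d) (sphereMeasure d) := by
  refine ⟨T.continuous.measurable, ?_⟩
  ext s hs
  rw [Measure.map_apply T.continuous.measurable hs, sphereMeasure_apply hs,
    sphereMeasure_apply (T.continuous.measurable hs)]
  congr 2
  have : Ioo (0 : ℝ) 1 • (T ⁻¹' s ∩ sphere 0 1) = T ⁻¹' (Ioo (0 : ℝ) 1 • (s ∩ sphere 0 1)) := by
    ext x
    simp only [Set.mem_smul, mem_preimage, mem_inter_iff]
    constructor
    · rintro ⟨r, hr, y, ⟨hy, hy1⟩, rfl⟩
      refine ⟨r, hr, T y, ⟨hy, by simpa using hy1⟩, ?_⟩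
      rw [← Complex.coe_smul, ← Complex.coe_smul, map_smul]
    · rintro ⟨r, hr, y, ⟨hy, hy1⟩, hx⟩
      refine ⟨r, hr, T.symm y, ⟨by simpa using hy, by simpa using hy1⟩, ?_⟩
      apply T.injective
      rw [← hx, ← Complex.coe_smul, ← Complex.coe_smul, map_smul, T.apply_symm_apply]
  rw [this]
  have hm := measurePreserving_addHaar_linearIsometryEquiv T
  exact MeasurePreserving.measure_preimage_equiv (f := T.toHomeomorph.toMeasurableEquiv) hm _

theorem integral_sphereMeasure_comp {d : ℕ} (T : CSpace d ≃ₗᵢ[ℂ] CSpace d)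
    {E : Type*} [NormedAddCommGroup E] [NormedSpace ℝ E] (F : CSpace d → E) :
    ∫ ζ, F (T ζ) ∂(sphereMeasure d) = ∫ ζ, F ζ ∂(sphereMeasure d) :=
  (measurePreserving_sphereMeasure T).integral_comp T.toHomeomorph.measurableEmbedding F

/-! ### Moments of a coordinate on the sphere, from Gaussian integrals. -/

theorem integral_addHaar_polar {E : Type*} [NormedAddCommGroup E] [NormedSpace ℝ E]
    [MeasurableSpace E] [BorelSpace E] [FiniteDimensional ℝ E] [Nontrivial E]
    (μ : Measure E) [μ.IsAddHaarMeasure] (h : E → ℝ) (u : ℝ → ℝ) :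
    ∫ x, h (‖x‖⁻¹ • x) * u ‖x‖ ∂μ =
      (∫ ζ : sphere (0 : E) 1, h ζ ∂μ.toSphere) *
        ∫ y in Ioi (0 : ℝ), y ^ (Module.finrank ℝ E - 1) * u y :=
  calc
    ∫ x, h (‖x‖⁻¹ • x) * u ‖x‖ ∂μ
      = ∫ x : ({(0)}ᶜ : Set E), h (‖x.1‖⁻¹ • x.1) * u (‖x.1‖) ∂(μ.comap (↑)) := by
      rw [integral_subtype_comap (measurableSet_singleton _).compl
        fun x ↦ h (‖x‖⁻¹ • x) * u (‖x‖), restrict_compl_singleton]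
    _ = ∫ x : sphere (0 : E) 1 × Ioi (0 : ℝ), h x.1 * u x.2
        ∂μ.toSphere.prod (.volumeIoiPow (Module.finrank ℝ E - 1)) := by
      simpa using μ.measurePreserving_homeomorphUnitSphereProd.integral_comp
        (Homeomorph.measurableEmbedding _)
        (fun x : sphere (0 : E) 1 × Ioi (0 : ℝ) => h x.1 * u x.2)
    _ = (∫ ζ : sphere (0 : E) 1, h ζ ∂μ.toSphere) *
        ∫ x : Ioi (0 : ℝ), u x ∂.volumeIoiPow (Module.finrank ℝ E - 1) :=
      integral_prod_mul (fun x : sphere (0 : E) 1 => h x) (fun y : Ioi (0 : ℝ) => u y)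
    _ = _ := by
      congr 1
      simp only [Measure.volumeIoiPow, ENNReal.ofReal]
      rw [integral_withDensity_eq_integral_smul,
        integral_subtype_comap measurableSet_Ioi
          fun a ↦ Real.toNNReal (a ^ (Module.finrank ℝ E - 1)) • u a,
        setIntegral_congr_fun measurableSet_Ioi fun x hx ↦ ?_]
      · rw [NNReal.smul_def, Real.coe_toNNReal _ (pow_nonneg hx.out.le _), smul_eq_mul]
      · exact (measurable_subtype_coe.pow_const _).real_toNNReal

theorem integral_sphereMeasure {d : ℕ} (h : CSpace d → ℝ) :
    ∫ ζ, h ζ ∂(sphereMeasure d) =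
      ((Measure.addHaar : Measure (CSpace d)).toSphere univ)⁻¹.toReal *
        ∫ ζ : sphere (0 : CSpace d) 1, h ζ ∂(Measure.addHaar : Measure (CSpace d)).toSphere := by
  rw [sphereMeasure, integral_smul_measure, smul_eq_mul]
  congr 1
  exact (MeasurableEmbedding.subtype_coe isClosed_sphere.measurableSet).integral_map _

theorem integral_Ioi_pow_mul_exp_neg_sq (k : ℕ) :
    ∫ y in Ioi (0 : ℝ), y ^ (2 * k + 1) * Real.exp (-y ^ 2) = (k.factorial : ℝ) / 2 := by
  have h := integral_rpow_mul_exp_neg_rpow (p := 2) (q := (2 * k + 1 : ℕ)) (by norm_num)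
    (by have : (0 : ℝ) ≤ ((2 * k + 1 : ℕ) : ℝ) := by positivity
        linarith)
  have e : (((2 * k + 1 : ℕ) : ℝ) + 1) / 2 = k + 1 := by push_cast; ring
  rw [e, Real.Gamma_nat_eq_factorial] at h
  rw [div_eq_inv_mul, ← one_div, ← h]
  refine setIntegral_congr_fun measurableSet_Ioi fun x hx => ?_
  simp only [Real.rpow_natCast, Real.rpow_two]

theorem integral_complex_norm_pow_mul_exp_neg_sq (m : ℕ) :
    ∫ z : ℂ, ‖z‖ ^ (2 * m) * Real.exp (-‖z‖ ^ 2) = Real.pi * m.factorial := by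
  have h := Complex.integral_rpow_mul_exp_neg_rpow (p := 2) (q := (2 * m : ℕ)) (by norm_num)
    (by have : (0 : ℝ) ≤ ((2 * m : ℕ) : ℝ) := by positivity
        linarith)
  have e : (((2 * m : ℕ) : ℝ) + 2) / 2 = m + 1 := by push_cast; ring
  rw [e, Real.Gamma_nat_eq_factorial] at h
  simpa only [Real.rpow_natCast, Real.rpow_two, mul_div_cancel_left₀ _ (two_ne_zero (α := ℝ))]
    using h

/-- The Gaussian factors over the coordinates, and only the `i`-th factor sees `m`. The constant
collects the Haar normalization and `π ^ d`; that it depends on neither `i` nor `m` lets it be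
eliminated later. -/
theorem integral_addHaar_norm_coord_pow_mul_exp {d : ℕ} :
    ∃ c : ℝ, 0 < c ∧ ∀ (i : Fin d) (m : ℕ),
      ∫ x : CSpace d, ‖x i‖ ^ (2 * m) * Real.exp (-‖x‖ ^ 2) ∂Measure.addHaar =
        c * m.factorial := by
  let L : CSpace d ≃L[ℝ] (Fin d → ℂ) := PiLp.continuousLinearEquiv 2 ℝ (fun _ : Fin d => ℂ)
  have hL := Measure.isAddLeftInvariant_eq_smul
    ((Measure.addHaar : Measure (CSpace d)).map L) (volume : Measure (Fin d → ℂ))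
  set c := Measure.addHaarScalarFactor
    ((Measure.addHaar : Measure (CSpace d)).map L) (volume : Measure (Fin d → ℂ)) with hc
  have hc0 : 0 < c := Measure.addHaarScalarFactor_pos_of_isAddHaarMeasure _ _
  refine ⟨c * Real.pi ^ d, by positivity, fun i m => ?_⟩
  have h1 : ∫ x : CSpace d, ‖x i‖ ^ (2 * m) * Real.exp (-‖x‖ ^ 2) ∂Measure.addHaar =
      ∫ y : Fin d → ℂ, ‖y i‖ ^ (2 * m) * Real.exp (-∑ j, ‖y j‖ ^ 2)
        ∂((Measure.addHaar : Measure (CSpace d)).map L) := by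
    rw [L.toHomeomorph.measurableEmbedding.integral_map
      (f := L) (μ := (Measure.addHaar : Measure (CSpace d)))]
    refine integral_congr_ae (ae_of_all _ fun x => ?_)
    simp only [EuclideanSpace.norm_sq_eq]
    rfl
  rw [h1, hL, integral_smul_nnreal_measure]
  have h2 : ∀ y : Fin d → ℂ, ‖y i‖ ^ (2 * m) * Real.exp (-∑ j, ‖y j‖ ^ 2) =
      ∏ j, ‖y j‖ ^ (2 * (if j = i then m else 0)) * Real.exp (-‖y j‖ ^ 2) := by
    intro y
    rw [Finset.prod_mul_distrib, ← Real.exp_sum, Finset.sum_neg_distrib]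
    congr 1
    rw [Finset.prod_eq_single i]
    · simp
    · intro j _ hj; simp [hj]
    · simp
  simp_rw [h2]
  rw [integral_fintype_prod_volume_eq_prod
    (fun (j : Fin d) (z : ℂ) => ‖z‖ ^ (2 * (if j = i then m else 0)) * Real.exp (-‖z‖ ^ 2))]
  simp_rw [integral_complex_norm_pow_mul_exp_neg_sq]
  rw [Finset.prod_mul_distrib, Finset.prod_eq_single (f := fun j : Fin d =>
    (((if j = i then m else 0).factorial : ℕ) : ℝ)) i]
  · simp [NNReal.smul_def, mul_assoc]
  · intro j _ hj; simp [hj]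
  · simp

theorem finrank_real_cspace (d : ℕ) : Module.finrank ℝ (CSpace d) = 2 * d := by
  rw [finrank_real_of_complex, finrank_euclideanSpace, Fintype.card_fin]

/-- The Gaussian moment is computed twice, coordinatewise and in polar coordinates. The binomial
coefficient is also the Taylor coefficient of `(1 - t)^(-d)`, which is what makes the Cauchy kernel
reproducing. -/
theorem integral_sphereMeasure_norm_coord_pow {d : ℕ} (hd : 1 ≤ d) (i : Fin d) (m : ℕ) :
    (((m + (d - 1)).choose (d - 1) : ℕ) : ℝ) *
      ∫ ζ, ‖ζ i‖ ^ (2 * m) ∂(sphereMeasure d) = 1 := by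
  have : Nonempty (Fin d) := ⟨⟨0, hd⟩⟩
  have := isProbabilityMeasure_sphereMeasure hd
  obtain ⟨c, hc, H⟩ := integral_addHaar_norm_coord_pow_mul_exp (d := d)
  set K := ((Measure.addHaar : Measure (CSpace d)).toSphere univ)⁻¹.toReal with hK
  have key : ∀ k : ℕ, K * (c * k.factorial) =
      (∫ ζ, ‖ζ i‖ ^ (2 * k) ∂(sphereMeasure d)) * (((k + (d - 1)).factorial : ℝ) / 2) := by
    intro k
    rw [← H i k, integral_sphereMeasure (fun ζ : CSpace d => ‖ζ i‖ ^ (2 * k)),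
      ← integral_Ioi_pow_mul_exp_neg_sq, ← hK, mul_assoc]
    congr 1
    have hp := integral_addHaar_polar (Measure.addHaar : Measure (CSpace d))
      (fun ζ => ‖ζ i‖ ^ (2 * k)) (fun y => y ^ (2 * k) * Real.exp (-y ^ 2))
    have e : ∀ y : ℝ, y ^ (Module.finrank ℝ (CSpace d) - 1) * (y ^ (2 * k) * Real.exp (-y ^ 2)) =
        y ^ (2 * (k + (d - 1)) + 1) * Real.exp (-y ^ 2) := by
      intro y
      rw [finrank_real_cspace, ← mul_assoc, ← pow_add]
      congr 2
      omega
    simp_rw [e] at hp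
    rw [← hp]
    refine integral_congr_ae ?_
    have h0 : ∀ᵐ x ∂(Measure.addHaar : Measure (CSpace d)), x ≠ 0 := by
      rw [ae_iff]; simp
    filter_upwards [h0] with x hx
    have hx' : ‖x‖ ≠ 0 := norm_ne_zero_iff.2 hx
    rw [← mul_assoc]
    congr 1
    rw [PiLp.smul_apply, norm_smul, norm_inv, norm_norm, ← mul_pow]
    field_simp
  -- For exponent `0` the sphere integral is `1`, which determines the unknown product `K * c`.
  have k0 := key 0
  have km := key m
  simp only [mul_zero, pow_zero, integral_const, probReal_univ, smul_eq_mul, mul_one, one_mul,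
    zero_add, Nat.factorial_zero, Nat.cast_one] at k0
  have hch : (((m + (d - 1)).choose (d - 1) : ℕ) : ℝ) * m.factorial * (d - 1).factorial =
      (m + (d - 1)).factorial := by
    have h := Nat.add_choose_mul_factorial_mul_factorial m (d - 1)
    exact_mod_cast h
  have hf : (0 : ℝ) < (m + (d - 1)).factorial := by positivity
  have hmf : (0 : ℝ) < m.factorial := by positivity
  set I := ∫ ζ, ‖ζ i‖ ^ (2 * m) ∂(sphereMeasure d)
  have : (m + (d - 1)).factorial * I = (m.factorial : ℝ) * (d - 1).factorial := by
    linear_combination (-2) * km + 2 * m.factorial * k0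
  have h3 : ((m.factorial : ℝ) * (d - 1).factorial) *
      ((((m + (d - 1)).choose (d - 1) : ℕ) : ℝ) * I) =
      ((m.factorial : ℝ) * (d - 1).factorial) * 1 := by
    linear_combination this + I * hch
  exact mul_left_cancel₀ (by positivity) h3

/-- Complete `η` to an orthonormal basis and take coordinates in it. -/
theorem exists_linearIsometryEquiv_apply_eq_coord {d : ℕ} (η : CSpace d)
    (hη : ‖η‖ = 1) : ∃ (T : CSpace d ≃ₗᵢ[ℂ] CSpace d) (i : Fin d),
      ∀ ζ, inner ℂ η ζ = (T ζ) i := by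
  have ho : Orthonormal ℂ (fun x : ({η} : Set (CSpace d)) => (x : CSpace d)) := by
    rw [orthonormal_iff_ite]
    rintro ⟨x, rfl⟩ ⟨y, hy⟩
    have : y = x := hy
    subst this
    simp [inner_self_eq_norm_sq_to_K, hη]
  obtain ⟨u, b, hu, hb⟩ := ho.exists_orthonormalBasis_extension
  have hη' : η ∈ u := hu rfl
  have hcard : Fintype.card u = d := by
    have := Module.finrank_eq_card_basis b.toBasis
    rw [finrank_euclideanSpace, Fintype.card_fin] at this
    exact this.symm
  let e : u ≃ Fin d := Fintype.equivFinOfCardEq hcard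
  refine ⟨(b.reindex e).repr, e ⟨η, hη'⟩, fun ζ => ?_⟩
  rw [OrthonormalBasis.repr_apply_apply]
  simp [hb]

theorem integral_sphereMeasure_norm_inner_pow {d : ℕ} (hd : 1 ≤ d) {η : CSpace d}
    (hη : ‖η‖ = 1) (m : ℕ) :
    (((m + (d - 1)).choose (d - 1) : ℕ) : ℝ) *
      ∫ ζ, ‖(inner ℂ η ζ : ℂ)‖ ^ (2 * m) ∂(sphereMeasure d) = 1 := by
  obtain ⟨T, i, hT⟩ := exists_linearIsometryEquiv_apply_eq_coord η hη
  rw [← integral_sphereMeasure_norm_coord_pow hd i m,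
    ← integral_sphereMeasure_comp T (fun ζ => ‖ζ i‖ ^ (2 * m))]
  simp_rw [hT]

/-! ### Averaging over rotations and the Cauchy formula. -/

theorem sphereMeasure_restrict_sphere {d : ℕ} :
    (sphereMeasure d).restrict (sphere 0 1) = sphereMeasure d := by
  refine Measure.restrict_eq_self_of_ae_mem ?_
  filter_upwards [ae_sphereMeasure_norm_eq] with ζ hζ using by simpa using hζ

theorem ContinuousOn.integrable_sphereMeasure {d : ℕ} (hd : 1 ≤ d) {E : Type*}
    [NormedAddCommGroup E] {F : CSpace d → E} (hF : ContinuousOn F (sphere 0 1)) :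
    Integrable F (sphereMeasure d) := by
  have := isProbabilityMeasure_sphereMeasure hd
  rw [← sphereMeasure_restrict_sphere]
  exact hF.integrableOn_compact (isCompact_sphere _ _)

theorem integral_sphereMeasure_eq_average {d : ℕ} (hd : 1 ≤ d)
    (T : ℝ → CSpace d ≃ₗᵢ[ℂ] CSpace d) (hT : Continuous fun p : ℝ × CSpace d => T p.1 p.2)
    {F : CSpace d → ℂ} (hF : ContinuousOn F (sphere 0 1)) :
    ∫ ζ, F ζ ∂(sphereMeasure d) =
      ∫ ζ, ((2 * Real.pi)⁻¹ • ∫ θ in (0 : ℝ)..(2 * Real.pi), F (T θ ζ)) ∂(sphereMeasure d) := by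
  have := isProbabilityMeasure_sphereMeasure hd
  have hpi := Real.pi_pos
  have hint : Integrable (Function.uncurry fun (ζ : CSpace d) (θ : ℝ) => F (T θ ζ))
      ((sphereMeasure d).prod (volume.restrict (Ioc 0 (2 * Real.pi)))) := by
    rw [← sphereMeasure_restrict_sphere, Measure.prod_restrict]
    refine IntegrableOn.mono_set ?_ (prod_mono_right Ioc_subset_Icc_self)
    refine ContinuousOn.integrableOn_compact ((isCompact_sphere _ _).prod isCompact_Icc) ?_
    refine hF.comp (f := fun p : CSpace d × ℝ => T p.2 p.1)
      (hT.comp continuous_swap).continuousOn ?_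
    rintro ⟨ζ, θ⟩ ⟨h, -⟩
    simpa using h
  simp_rw [intervalIntegral.integral_of_le (by positivity : (0 : ℝ) ≤ 2 * Real.pi)]
  rw [integral_smul, integral_integral_swap hint]
  simp_rw [integral_sphereMeasure_comp]
  simp only [integral_const, MeasurableSet.univ, measureReal_restrict_apply, univ_inter,
    Real.volume_real_Ioc, sub_zero]
  rw [max_eq_left (by positivity), smul_smul, inv_mul_cancel₀ (by positivity), one_smul]

/-- Multiplication by a unimodular scalar. -/
noncomputable def scalarRotation (d : ℕ) (v : ℂ) (hv : ‖v‖ = 1) : CSpace d ≃ₗᵢ[ℂ] CSpace d :=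
  LinearIsometry.toLinearIsometryEquiv
    { toLinearMap := v • LinearMap.id
      norm_map' := fun ζ => by simp [norm_smul, hv] } rfl

theorem scalarRotation_apply {d : ℕ} (v : ℂ) (hv : ‖v‖ = 1) (ζ : CSpace d) :
    scalarRotation d v hv ζ = v • ζ := rfl

theorem norm_sq_slice {d : ℕ} {η : CSpace d} (hη : ‖η‖ = 1) (v : ℂ) (ζ : CSpace d) :
    ‖(inner ℂ η ζ : ℂ) • η + v • (ζ - (inner ℂ η ζ : ℂ) • η)‖ ^ 2 =
      ‖(inner ℂ η ζ : ℂ)‖ ^ 2 + ‖v‖ ^ 2 * ‖ζ - (inner ℂ η ζ : ℂ) • η‖ ^ 2 := by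
  have h0 : inner ℂ ((inner ℂ η ζ : ℂ) • η) (v • (ζ - (inner ℂ η ζ : ℂ) • η)) = 0 := by
    rw [inner_smul_left, inner_smul_right, inner_sub_right, inner_smul_right,
      inner_self_eq_norm_sq_to_K, hη]
    simp
  have := norm_add_sq_eq_norm_sq_add_norm_sq_of_inner_eq_zero _ _ h0
  rw [sq, this, norm_smul, norm_smul, hη]
  ring

theorem norm_sq_slice_orthogonal {d : ℕ} {η : CSpace d} (hη : ‖η‖ = 1) (ζ : CSpace d) :
    ‖ζ‖ ^ 2 = ‖(inner ℂ η ζ : ℂ)‖ ^ 2 + ‖ζ - (inner ℂ η ζ : ℂ) • η‖ ^ 2 := by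
  have := norm_sq_slice hη 1 ζ
  simpa using this

/-- Multiplication of the component orthogonal to the unit vector `η` by a unimodular scalar. -/
noncomputable def sliceRotation {d : ℕ} (η : CSpace d) (hη : ‖η‖ = 1) (v : ℂ) (hv : ‖v‖ = 1) :
    CSpace d ≃ₗᵢ[ℂ] CSpace d :=
  LinearIsometry.toLinearIsometryEquiv
    { toFun := fun ζ => (inner ℂ η ζ : ℂ) • η + v • (ζ - (inner ℂ η ζ : ℂ) • η)
      map_add' := fun x y => by
        simp only [inner_add_right]; module
      map_smul' := fun c x => by
        simp only [inner_smul_right, RingHom.id_apply]; module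
      norm_map' := fun ζ => by
        have h1 := norm_sq_slice hη v ζ
        rw [hv, one_pow, one_mul, ← norm_sq_slice_orthogonal hη] at h1
        exact (sq_eq_sq₀ (norm_nonneg _) (norm_nonneg _)).1 h1 } rfl

theorem sliceRotation_apply {d : ℕ} (η : CSpace d) (hη : ‖η‖ = 1) (v : ℂ) (hv : ‖v‖ = 1)
    (ζ : CSpace d) : sliceRotation η hη v hv ζ =
      (inner ℂ η ζ : ℂ) • η + v • (ζ - (inner ℂ η ζ : ℂ) • η) := rfl

theorem inner_sliceRotation {d : ℕ} (η : CSpace d) (hη : ‖η‖ = 1) (v : ℂ) (hv : ‖v‖ = 1)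
    (ζ : CSpace d) : inner ℂ η (sliceRotation η hη v hv ζ) = inner ℂ η ζ := by
  simp [sliceRotation_apply,
    inner_self_eq_norm_sq_to_K, hη]

theorem norm_circleMap_zero_one (θ : ℝ) : ‖circleMap 0 1 θ‖ = 1 := by simp

theorem DiffContOnCl.comp_smul_unit {d : ℕ} {f : CSpace d → ℂ}
    (hf : DiffContOnCl ℂ f (ball 0 1)) {η : CSpace d} (hη : ‖η‖ = 1) :
    DiffContOnCl ℂ (fun u : ℂ => f (u • η)) (ball 0 1) := by
  refine hf.comp (g := fun u : ℂ => u • η) ?_ ?_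
  · exact (Differentiable.diffContOnCl (by fun_prop))
  · intro u hu
    simpa [norm_smul, hη] using hu

/-- The mean value property of `u ↦ f (P + u Q)`, where `P` is the component of `ζ` along `η` and
`Q` the orthogonal one. -/
theorem circleAverage_slice {d : ℕ} {f : CSpace d → ℂ} (hf : DiffContOnCl ℂ f (ball 0 1))
    {η : CSpace d} (hη : ‖η‖ = 1) {ζ : CSpace d} (hζ : ‖ζ‖ = 1) :
    (2 * Real.pi)⁻¹ • ∫ θ in (0 : ℝ)..(2 * Real.pi),
      f (sliceRotation η hη (circleMap 0 1 θ) (norm_circleMap_zero_one θ) ζ) =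
    f ((inner ℂ η ζ : ℂ) • η) := by
  set P := (inner ℂ η ζ : ℂ) • η with hP
  set Q := ζ - P with hQ
  have key : Real.circleAverage (fun u : ℂ => f (P + u • Q)) 0 1 = f (P + (0 : ℂ) • Q) := by
    -- If `Q = 0` then `P` lies on the sphere and the disc is not mapped into the open ball, but the
    -- function is constant.
    by_cases hQ0 : Q = 0
    · simp only [hQ0, smul_zero, add_zero]
      exact Real.circleAverage_const _ _ _
    · refine DiffContOnCl.circleAverage ?_
      refine hf.comp (g := fun u : ℂ => P + u • Q) ?_ ?_
      · exact (Differentiable.diffContOnCl (by fun_prop))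
      · intro u hu
        rw [abs_one, mem_ball_zero_iff] at hu
        rw [mem_ball_zero_iff]
        have h1 := norm_sq_slice hη u ζ
        have h2 := norm_sq_slice_orthogonal hη ζ
        rw [← hP, ← hQ] at h1
        rw [← hP, ← hQ, hζ] at h2
        have h3 : 0 < ‖Q‖ := norm_pos_iff.2 hQ0
        have h4 : ‖u‖ ^ 2 < 1 := by nlinarith [norm_nonneg u]
        have h5 : ‖P + u • Q‖ ^ 2 < 1 := by
          rw [h1]; nlinarith [mul_pos h3 h3]
        nlinarith [norm_nonneg (P + u • Q)]
  rw [zero_smul, add_zero, Real.circleAverage_def] at key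
  exact key

theorem iteratedDeriv_comp_mul_of_differentiableOn_ball {F : ℂ → ℂ}
    (hF : DifferentiableOn ℂ F (ball 0 1)) {c : ℂ} (hc : ‖c‖ ≤ 1) (m : ℕ) :
    iteratedDeriv m (fun u => F (c * u)) 0 = c ^ m * iteratedDeriv m F 0 := by
  have h0 : (0 : ℂ) ∈ ball (0 : ℂ) 1 := by simp
  have hmaps : MapsTo (c * ·) (ball (0 : ℂ) 1) (ball (0 : ℂ) 1) := by
    intro u hu
    rw [mem_ball_zero_iff] at hu ⊢
    rw [norm_mul]
    nlinarith [norm_nonneg u, norm_nonneg c]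
  have h := iteratedDerivWithin_comp_const_smul h0 isOpen_ball.uniqueDiffOn
    ((hF.contDiffOn isOpen_ball).of_le le_top : ContDiffOn ℂ m F _) c hmaps
  rw [iteratedDerivWithin_of_isOpen isOpen_ball h0, mul_zero,
    iteratedDerivWithin_of_isOpen isOpen_ball h0] at h
  exact h

/-- On the unit circle `conj u = u⁻¹`, so the average is the Cauchy integral for the `m`-th Taylor
coefficient of `u ↦ F (c u)`. -/
theorem circleAverage_mul_conj_pow {F : ℂ → ℂ} (hF : DiffContOnCl ℂ F (ball 0 1)) {c : ℂ}
    (hc : ‖c‖ ≤ 1) (m : ℕ) :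
    (2 * Real.pi)⁻¹ • ∫ θ in (0 : ℝ)..(2 * Real.pi),
      F (circleMap 0 1 θ * c) * conj (circleMap 0 1 θ * c) ^ m =
    (iteratedDeriv m F 0 / m.factorial) * ((‖c‖ ^ (2 * m) : ℝ) : ℂ) := by
  have hFc : DiffContOnCl ℂ (fun u => F (c * u)) (ball 0 1) := by
    by_cases h0 : c = 0
    · simp only [h0, zero_mul]
      exact diffContOnCl_const
    · refine hF.comp (g := fun u => c * u) (Differentiable.diffContOnCl (by fun_prop)) ?_
      intro u hu
      rw [mem_ball_zero_iff] at hu ⊢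
      rw [norm_mul]
      nlinarith [norm_nonneg u, norm_nonneg c]
  have h1 := hFc.circleIntegral_one_div_sub_center_pow_smul one_pos m
  rw [iteratedDeriv_comp_mul_of_differentiableOn_ball hF.1 hc] at h1
  have h2 : Real.circleAverage (fun u => F (u * c) * conj (u * c) ^ m) 0 1 =
      conj c ^ m * ((2 * Real.pi * Complex.I)⁻¹ •
        ∮ z in C(0, 1), (1 / (z - 0) ^ (m + 1)) • F (c * z)) := by
    rw [Real.circleAverage_eq_circleIntegral one_ne_zero, mul_smul_comm]
    congr 1
    rw [← circleIntegral.integral_const_mul]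
    refine circleIntegral.integral_congr zero_le_one fun z hz => ?_
    have hz1 : ‖z‖ = 1 := by simpa using hz
    have hzc : conj z = z⁻¹ := by
      rw [Complex.inv_def, Complex.normSq_eq_norm_sq, hz1]; simp
    simp only [map_mul, hzc, sub_zero, smul_eq_mul, mul_pow, one_div, pow_succ, mul_inv,
      inv_pow, mul_comm z c]
    ring
  rw [Real.circleAverage_def] at h2
  rw [h2, h1]
  have hc2 : ((‖c‖ ^ (2 * m) : ℝ) : ℂ) = conj c ^ m * c ^ m := by
    rw [← mul_pow, mul_comm (conj c), Complex.mul_conj, Complex.normSq_eq_norm_sq, pow_mul]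
    push_cast; rfl
  rw [hc2]
  have hpi : (2 * Real.pi * Complex.I) ≠ 0 := Complex.two_pi_I_ne_zero
  simp only [smul_eq_mul]
  field_simp

theorem continuous_circleMap_smul {d : ℕ} :
    Continuous fun p : ℝ × CSpace d => circleMap 0 1 p.1 • p.2 :=
  ((continuous_circleMap 0 1).comp continuous_fst).smul continuous_snd

/-- Two averages: rotating the component orthogonal to `η` replaces `f` by its restriction to the
complex line through `η`; rotating the whole vector by a phase then selects the `m`-th Taylor
coefficient of that restriction. -/
theorem integral_mul_conj_inner_pow {d : ℕ} (hd : 1 ≤ d) {f : CSpace d → ℂ}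
    (hf : DiffContOnCl ℂ f (ball 0 1)) {η : CSpace d} (hη : ‖η‖ = 1) (m : ℕ) :
    ∫ ζ, f ζ * conj (inner ℂ η ζ) ^ m ∂(sphereMeasure d) =
      (iteratedDeriv m (fun u : ℂ => f (u • η)) 0 / m.factorial) *
        ((∫ ζ, ‖(inner ℂ η ζ : ℂ)‖ ^ (2 * m) ∂(sphereMeasure d) : ℝ) : ℂ) := by
  have hfc : ContinuousOn f (closedBall 0 1) := by
    have := hf.continuousOn; rwa [closure_ball _ one_ne_zero] at this
  have hF := hf.comp_smul_unit hη
  have hFc : ContinuousOn (fun u : ℂ => f (u • η)) (closedBall 0 1) := by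
    have := hF.continuousOn; rwa [closure_ball _ one_ne_zero] at this
  have hci : Continuous fun ζ : CSpace d => conj (inner ℂ η ζ : ℂ) ^ m :=
    (Complex.continuous_conj.comp (continuous_const.inner continuous_id)).pow m
  have hin : ∀ {ζ : CSpace d}, ‖ζ‖ = 1 → ‖(inner ℂ η ζ : ℂ)‖ ≤ 1 := by
    intro ζ hζ
    simpa [hη, hζ] using norm_inner_le_norm (𝕜 := ℂ) η ζ
  calc ∫ ζ, f ζ * conj (inner ℂ η ζ) ^ m ∂(sphereMeasure d)
      = ∫ ζ, f ((inner ℂ η ζ : ℂ) • η) * conj (inner ℂ η ζ) ^ m ∂(sphereMeasure d) := by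
        rw [integral_sphereMeasure_eq_average hd
          (fun θ => sliceRotation η hη (circleMap 0 1 θ) (norm_circleMap_zero_one θ))
          _ (F := fun ζ => f ζ * conj (inner ℂ η ζ) ^ m)
          ((hfc.mono sphere_subset_closedBall).mul hci.continuousOn)]
        · refine integral_congr_ae ?_
          filter_upwards [ae_sphereMeasure_norm_eq] with ζ hζ
          simp only [inner_sliceRotation]
          rw [intervalIntegral.integral_mul_const, ← smul_mul_assoc, circleAverage_slice hf hη hζ]
        · simp only [sliceRotation_apply]
          have h1 : Continuous fun p : ℝ × CSpace d => (inner ℂ η p.2 : ℂ) • η := by fun_prop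
          exact h1.add (((continuous_circleMap 0 1).comp continuous_fst).smul
            (continuous_snd.sub h1))
    _ = ∫ ζ, (iteratedDeriv m (fun u : ℂ => f (u • η)) 0 / m.factorial) *
          ((‖(inner ℂ η ζ : ℂ)‖ ^ (2 * m) : ℝ) : ℂ) ∂(sphereMeasure d) := by
        rw [integral_sphereMeasure_eq_average hd
          (fun θ => scalarRotation d (circleMap 0 1 θ) (norm_circleMap_zero_one θ))
          continuous_circleMap_smul]
        · refine integral_congr_ae ?_
          filter_upwards [ae_sphereMeasure_norm_eq] with ζ hζ
          simp only [scalarRotation_apply, inner_smul_right]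
          exact circleAverage_mul_conj_pow hF (hin hζ) m
        · refine ContinuousOn.mul ?_ hci.continuousOn
          refine hFc.comp (f := fun ζ : CSpace d => (inner ℂ η ζ : ℂ))
            (continuous_const.inner continuous_id).continuousOn ?_
          intro ζ hζ
          simpa using hin (by simpa using hζ)
    _ = _ := by
        rw [integral_const_mul, integral_complex_ofReal]

theorem exists_unit_smul_eq {d : ℕ} (hd : 1 ≤ d) (w : CSpace d) :
    ∃ η : CSpace d, ‖η‖ = 1 ∧ w = ((‖w‖ : ℝ) : ℂ) • η := by
  by_cases hw : w = 0
  · exact ⟨EuclideanSpace.single ⟨0, hd⟩ 1, by simp, by simp [hw]⟩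
  · have : ‖w‖ ≠ 0 := norm_ne_zero_iff.2 hw
    refine ⟨((‖w‖ : ℝ) : ℂ)⁻¹ • w, by simp [norm_smul, this], ?_⟩
    rw [smul_smul, mul_inv_cancel₀ (by exact_mod_cast this), one_smul]

theorem one_sub_inner_ne_zero {d : ℕ} {z w : CSpace d} (hz : ‖z‖ ≤ 1) (hw : ‖w‖ < 1) :
    (1 : ℂ) - inner ℂ z w ≠ 0 := by
  intro h
  have h1 : ‖(inner ℂ z w : ℂ)‖ = 1 := by rw [← sub_eq_zero.1 h]; simp
  have := norm_inner_le_norm (𝕜 := ℂ) z w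
  nlinarith [norm_nonneg z, norm_nonneg w]

/-- The Cauchy formula on the unit ball of `ℂ^d`. -/
theorem integral_div_one_sub_inner_pow {d : ℕ} (hd : 1 ≤ d) {f : CSpace d → ℂ}
    (hf : DiffContOnCl ℂ f (ball 0 1)) {w : CSpace d} (hw : ‖w‖ < 1) :
    ∫ ζ, f ζ / (1 - inner ℂ ζ w) ^ d ∂(sphereMeasure d) = f w := by
  have := isProbabilityMeasure_sphereMeasure hd
  obtain ⟨η, hη, hwη⟩ := exists_unit_smul_eq hd w
  set s : ℂ := ((‖w‖ : ℝ) : ℂ) with hs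
  have hs1 : ‖s‖ = ‖w‖ := by simp [hs]
  have hfc : ContinuousOn f (closedBall 0 1) := by
    have := hf.continuousOn; rwa [closure_ball _ one_ne_zero] at this
  obtain ⟨k, rfl⟩ : ∃ k, d = k + 1 := ⟨d - 1, by omega⟩
  have hin : ∀ {ζ : CSpace (k + 1)}, ‖ζ‖ = 1 → ‖(inner ℂ η ζ : ℂ)‖ ≤ 1 := by
    intro ζ hζ
    simpa [hη, hζ] using norm_inner_le_norm (𝕜 := ℂ) η ζ
  have hinw : ∀ ζ : CSpace (k + 1), (inner ℂ ζ w : ℂ) = s * conj (inner ℂ η ζ) := by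
    intro ζ
    conv_lhs => rw [hwη]
    rw [inner_smul_right, inner_conj_symm]
  obtain ⟨M, hM⟩ := (isCompact_sphere (0 : CSpace (k + 1)) 1).exists_bound_of_continuousOn
    (hfc.mono sphere_subset_closedBall)
  -- The terms of the binomial series of `(1 - t)^(-(k + 1))` at `t = s * conj (inner ℂ η ζ)`, times
  -- `f`. Since `‖s‖ < 1` they are dominated uniformly in `ζ` by a convergent series.
  set G : ℕ → CSpace (k + 1) → ℂ := fun n ζ =>
    ((n + k).choose k : ℂ) * s ^ n * (f ζ * conj (inner ℂ η ζ) ^ n) with hG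
  have hci : ∀ n : ℕ, Continuous fun ζ : CSpace (k + 1) => conj (inner ℂ η ζ : ℂ) ^ n :=
    fun n => (Complex.continuous_conj.comp (continuous_const.inner continuous_id)).pow n
  have hGint : ∀ n, Integrable (G n) (sphereMeasure (k + 1)) := fun n =>
    ContinuousOn.integrable_sphereMeasure hd (continuousOn_const.mul
      ((hfc.mono sphere_subset_closedBall).mul (hci n).continuousOn))
  have hsw : ‖s‖ < 1 := by rw [hs1]; exact hw
  have hGsum : Summable fun n => ∫ ζ, ‖G n ζ‖ ∂(sphereMeasure (k + 1)) := by
    have hsum : Summable fun n : ℕ => ((n + k).choose k : ℝ) * ‖s‖ ^ n * M :=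
      ((hasSum_choose_mul_geometric_of_norm_lt_one k
        (by simpa using hsw : ‖‖s‖‖ < 1)).summable).mul_right M
    refine hsum.of_nonneg_of_le (fun n => integral_nonneg fun _ => norm_nonneg _) fun n => ?_
    have : ∫ ζ, ‖G n ζ‖ ∂(sphereMeasure (k + 1)) ≤
        ∫ _, ((n + k).choose k : ℝ) * ‖s‖ ^ n * M ∂(sphereMeasure (k + 1)) := by
      refine integral_mono_ae (hGint n).norm (integrable_const _) ?_
      filter_upwards [ae_sphereMeasure_norm_eq] with ζ hζ
      simp only [hG, norm_mul, norm_pow, Complex.norm_natCast, RCLike.norm_conj]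
      refine mul_le_mul_of_nonneg_left ?_ (by positivity)
      calc ‖f ζ‖ * ‖(inner ℂ η ζ : ℂ)‖ ^ n ≤ ‖f ζ‖ * 1 :=
            mul_le_mul_of_nonneg_left (pow_le_one₀ (norm_nonneg _) (hin hζ)) (norm_nonneg _)
        _ ≤ M := by rw [mul_one]; exact hM ζ (by simpa using hζ)
    simpa using this
  have h1 := hasSum_integral_of_summable_integral_norm hGint hGsum
  have h2 : ∫ ζ, ∑' n, G n ζ ∂(sphereMeasure (k + 1)) =
      ∫ ζ, f ζ / (1 - inner ℂ ζ w) ^ (k + 1) ∂(sphereMeasure (k + 1)) := by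
    refine integral_congr_ae ?_
    filter_upwards [ae_sphereMeasure_norm_eq] with ζ hζ
    have hr : ‖s * conj (inner ℂ η ζ)‖ < 1 := by
      rw [norm_mul, RCLike.norm_conj]
      nlinarith [hin hζ, norm_nonneg s, norm_nonneg (inner ℂ η ζ : ℂ)]
    have h3 := (hasSum_choose_mul_geometric_of_norm_lt_one k hr).mul_left (f ζ)
    rw [hinw, div_eq_mul_one_div, ← h3.tsum_eq]
    refine tsum_congr fun n => ?_
    simp only [hG, mul_pow]
    ring
  rw [h2] at h1
  have hF := hf.comp_smul_unit hη
  have h4 := Complex.hasSum_taylorSeries_on_ball hF.1 (z := s) (by simpa using hsw)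
  -- The binomial coefficient cancels the moment of order `2n`, leaving the Taylor term of `u ↦ f (u
  -- • η)` at `s`.
  have h5 : ∀ n, ∫ ζ, G n ζ ∂(sphereMeasure (k + 1)) =
      ((n.factorial : ℂ))⁻¹ • (s - 0) ^ n • iteratedDeriv n (fun u : ℂ => f (u • η)) 0 := by
    intro n
    simp only [hG]
    rw [integral_const_mul, integral_mul_conj_inner_pow hd hf hη n]
    have h6 := integral_sphereMeasure_norm_inner_pow hd hη n
    rw [Nat.add_sub_cancel] at h6
    have h7 : ((n + k).choose k : ℂ) *
      ((∫ ζ, ‖(inner ℂ η ζ : ℂ)‖ ^ (2 * n) ∂(sphereMeasure (k + 1)) : ℝ) : ℂ) = 1 := by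
      exact_mod_cast h6
    simp only [smul_eq_mul, sub_zero]
    linear_combination (s ^ n * (iteratedDeriv n (fun u : ℂ => f (u • η)) 0 / n.factorial)) * h7
  simp_rw [h5] at h1
  rw [h1.unique h4, ← hwη]

/-! ### The Poisson–Szegő formula. -/

theorem diffContOnCl_div_one_sub_inner_pow {d : ℕ} {f : CSpace d → ℂ}
    (hf : DiffContOnCl ℂ f (ball 0 1)) {w : CSpace d} (hw : ‖w‖ < 1) (n : ℕ) :
    DiffContOnCl ℂ (fun ζ => f ζ / (1 - inner ℂ w ζ) ^ n) (ball 0 1) := by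
  have h0 : ∀ ζ ∈ closure (ball (0 : CSpace d) 1), (1 - (inner ℂ w ζ : ℂ)) ^ n ≠ 0 := by
    intro ζ hζ
    rw [closure_ball _ one_ne_zero, mem_closedBall_zero_iff] at hζ
    refine pow_ne_zero _ fun h => ?_
    refine one_sub_inner_ne_zero hζ hw ?_
    rw [← inner_conj_symm, ← map_one conj, ← map_sub, h, map_zero]
  have hD : Differentiable ℂ fun ζ : CSpace d => (1 - (inner ℂ w ζ : ℂ)) ^ n := by
    have : Differentiable ℂ fun ζ : CSpace d => (inner ℂ w ζ : ℂ) :=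
      (innerSL ℂ w).differentiable
    fun_prop
  simp only [div_eq_mul_inv]
  exact hf.smul (hD.diffContOnCl.inv h0)

/-- The Poisson-Szegő kernel of the unit ball of `ℂ^d`. -/
noncomputable def poissonSzego {d : ℕ} (w z : CSpace d) : ℝ :=
  (1 - ‖w‖ ^ 2) ^ d / ‖1 - (inner ℂ w z : ℂ)‖ ^ (2 * d)

theorem norm_one_sub_inner_comm {d : ℕ} (z w : CSpace d) :
    ‖1 - (inner ℂ z w : ℂ)‖ = ‖1 - (inner ℂ w z : ℂ)‖ := by
  rw [← inner_conj_symm, ← map_one conj, ← map_sub, RCLike.norm_conj, map_one]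

/-- The Poisson formula on the unit ball of `ℂ^d`. -/
theorem integral_mul_poissonSzego {d : ℕ} (hd : 1 ≤ d) {f : CSpace d → ℂ}
    (hf : DiffContOnCl ℂ f (ball 0 1)) {w : CSpace d} (hw : ‖w‖ < 1) :
    ∫ ζ, f ζ * (poissonSzego w ζ : ℂ) ∂(sphereMeasure d) = f w := by
  -- The Cauchy formula for `f ζ / (1 - inner ℂ w ζ) ^ d`: its value at `w` is `f w / (1 - ‖w‖²) ^
  -- d`, and its denominator is the conjugate of the Cauchy denominator.
  have h := integral_div_one_sub_inner_pow hd (diffContOnCl_div_one_sub_inner_pow hf hw d) hw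
  have hw2 : (1 : ℂ) - ‖w‖ ^ 2 ≠ 0 := by
    have : (1 : ℝ) - ‖w‖ ^ 2 ≠ 0 := by nlinarith [norm_nonneg w]
    exact_mod_cast this
  rw [inner_self_eq_norm_sq_to_K, RCLike.ofReal_eq_complex_ofReal, eq_div_iff (pow_ne_zero _ hw2), mul_comm,
    ← integral_const_mul] at h
  rw [← h]
  refine integral_congr_ae (ae_of_all _ fun ζ => ?_)
  have e : ((‖1 - (inner ℂ w ζ : ℂ)‖ ^ (2 * d) : ℝ) : ℂ) =
      (1 - inner ℂ w ζ) ^ d * (1 - inner ℂ ζ w) ^ d := by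
    rw [← mul_pow, pow_mul, ← Complex.normSq_eq_norm_sq, Complex.ofReal_pow, ← Complex.mul_conj,
      map_sub, map_one, inner_conj_symm]
  simp only [poissonSzego, Complex.ofReal_div, e]
  push_cast
  rw [div_div, mul_div_assoc', mul_div_assoc']
  congr 1
  ring

theorem integral_poissonSzego {d : ℕ} (hd : 1 ≤ d) {w : CSpace d} (hw : ‖w‖ < 1) :
    ∫ ζ, poissonSzego w ζ ∂(sphereMeasure d) = 1 := by
  have h := integral_mul_poissonSzego hd (f := fun _ => 1) diffContOnCl_const hw
  simp only [one_mul] at h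
  rw [integral_complex_ofReal] at h
  exact_mod_cast h

/-! ### Fatou's theorem in the disc. -/

/-- Cauchy's formula for `dslope g z`, whose value at `z` is the derivative; the remaining part `g z
* (u - z)⁻²` has integral zero. -/
theorem DiffContOnCl.circleIntegral_sub_inv_sq_mul {g : ℂ → ℂ}
    (hg : DiffContOnCl ℂ g (ball 0 1)) {z : ℂ} (hz : z ∈ ball (0 : ℂ) 1) :
    ∮ u in C(0, 1), (u - z)⁻¹ ^ 2 * g u = (2 * Real.pi * Complex.I) * deriv g z := by
  have hgc := hg.continuousOn_ball
  have hgz := hg.differentiableAt isOpen_ball hz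
  have hh : DiffContOnCl ℂ (dslope g z) (ball 0 1) := by
    refine ⟨(Complex.differentiableOn_dslope (isOpen_ball.mem_nhds hz)).2 hg.1, ?_⟩
    rw [closure_ball _ one_ne_zero]
    exact (continuousOn_dslope (closedBall_mem_nhds_of_mem hz)).2 ⟨hgc, hgz⟩
  have h1 := hh.circleIntegral_sub_inv_smul hz
  rw [dslope_same, smul_eq_mul] at h1
  have hne : ∀ u ∈ sphere (0 : ℂ) 1, u - z ≠ 0 := by
    intro u hu h
    rw [sub_eq_zero.1 h] at hu
    rw [mem_ball_zero_iff] at hz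
    rw [mem_sphere_zero_iff_norm] at hu
    linarith
  have hinv : ContinuousOn (fun u : ℂ => (u - z)⁻¹ ^ 2) (sphere 0 1) :=
    ((continuousOn_id.sub continuousOn_const).inv₀ hne).pow 2
  have h2 : ∮ u in C(0, 1), (u - z)⁻¹ ^ 2 * g z = 0 := by
    have h3 := circleIntegral.integral_sub_zpow_of_ne (n := -2) (by norm_num) 0 z 1
    have e : ∀ u : ℂ, (u - z)⁻¹ ^ 2 * g z = g z * (u - z) ^ (-2 : ℤ) := by
      intro u
      rw [zpow_neg, mul_comm, inv_pow]; norm_cast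
    simp_rw [e]
    rw [circleIntegral.integral_const_mul, h3, mul_zero]
  have i1 : CircleIntegrable (fun u : ℂ => (u - z)⁻¹ ^ 2 * g u) 0 1 :=
    (hinv.mul (hgc.mono sphere_subset_closedBall)).circleIntegrable zero_le_one
  have i2 : CircleIntegrable (fun u : ℂ => (u - z)⁻¹ ^ 2 * g z) 0 1 :=
    (hinv.mul continuousOn_const).circleIntegrable zero_le_one
  have h3 := circleIntegral.integral_sub i1 i2
  rw [h2, sub_zero] at h3
  rw [← h1, ← h3]
  refine circleIntegral.integral_congr zero_le_one fun u hu => ?_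
  have := hne u hu
  rw [dslope_of_ne _ (sub_ne_zero.1 this), slope_def_field]
  simp only [smul_eq_mul]
  field_simp

theorem norm_sub_inv_eq {r : ℝ} (hr0 : 0 < r) {u : ℂ} (hu : ‖u‖ = 1) :
    ‖u - (r : ℂ)⁻¹‖ = ‖u - r‖ / r := by
  have h1 : u - (r : ℂ)⁻¹ = -(u * (r : ℂ)⁻¹ * conj (u - r)) := by
    have : u * conj u = 1 := by
      rw [Complex.mul_conj, Complex.normSq_eq_norm_sq, hu]; simp
    have hr : (r : ℂ) ≠ 0 := by exact_mod_cast hr0.ne'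
    rw [map_sub, Complex.conj_ofReal]
    field_simp
    linear_combination this
  rw [h1, norm_neg, norm_mul, norm_mul, RCLike.norm_conj, hu, norm_inv, Complex.norm_real,
    Real.norm_of_nonneg hr0.le]
  ring

/-- Subtracting the kernel at the reflected point `1/r` gains a factor of order `(1 - r²) / ‖u -
r‖`. Multiplied by a quantity of size `‖u - r‖`, the bound becomes a Poisson kernel, with integral
bounded in `r`, whereas `‖u - r‖⁻²` alone would lose a logarithm. -/
theorem norm_reflected_kernel_le {r : ℝ} (hr0 : 0 < r) (hr1 : r < 1) {u : ℂ} (hu : ‖u‖ = 1) :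
    ‖(u - r)⁻¹ ^ 2 - (u - (r : ℂ)⁻¹)⁻¹ ^ 2‖ ≤ 2 * (1 - r ^ 2) / ‖u - r‖ ^ 3 := by
  have hur : u - r ≠ 0 := by
    intro h
    rw [sub_eq_zero.1 h, Complex.norm_real, Real.norm_of_nonneg hr0.le] at hu
    linarith
  have hp : 0 < ‖u - r‖ := norm_pos_iff.2 hur
  have h1 := norm_sub_inv_eq hr0 hu
  have hur' : u - (r : ℂ)⁻¹ ≠ 0 := by
    rw [← norm_pos_iff, h1]; positivity
  have hr : (r : ℂ) ≠ 0 := by exact_mod_cast hr0.ne'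
  have e : (u - r)⁻¹ ^ 2 - (u - (r : ℂ)⁻¹)⁻¹ ^ 2 =
      ((r - (r : ℂ)⁻¹) * ((u - r) + (u - (r : ℂ)⁻¹))) / ((u - r) ^ 2 * (u - (r : ℂ)⁻¹) ^ 2) := by
    rw [eq_div_iff (mul_ne_zero (pow_ne_zero _ hur) (pow_ne_zero _ hur')), sub_mul, inv_pow,
      inv_pow, inv_mul_cancel_left₀ (pow_ne_zero _ hur), mul_comm ((u - r) ^ 2),
      inv_mul_cancel_left₀ (pow_ne_zero _ hur')]
    ring
  have e2 : ‖(r : ℂ) - (r : ℂ)⁻¹‖ = (1 - r ^ 2) / r := by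
    rw [← Complex.ofReal_inv, ← Complex.ofReal_sub, Complex.norm_real, ← norm_neg,
      Real.norm_of_nonneg]
    · field_simp; ring
    · have : 1 ≤ r⁻¹ := (one_le_inv₀ hr0).2 hr1.le
      linarith
  rw [e, norm_div, norm_mul, norm_mul, norm_pow, norm_pow, h1, e2]
  have h3 : ‖(u - r) + (u - (r : ℂ)⁻¹)‖ ≤ 2 * ‖u - r‖ / r := by
    refine (norm_add_le _ _).trans ?_
    rw [h1]
    rw [← add_halves (2 * ‖u - r‖ / r)]
    have : ‖u - r‖ ≤ ‖u - r‖ / r := by rw [le_div_iff₀ hr0]; nlinarith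
    linarith [show 2 * ‖u - r‖ / r / 2 = ‖u - r‖ / r by ring]
  have h4 : 0 ≤ (1 - r ^ 2) / r := by
    have : r ^ 2 < 1 := by nlinarith
    exact div_nonneg (by linarith) hr0.le
  calc (1 - r ^ 2) / r * ‖(u - r) + (u - (r : ℂ)⁻¹)‖ / (‖u - r‖ ^ 2 * (‖u - r‖ / r) ^ 2)
      ≤ (1 - r ^ 2) / r * (2 * ‖u - r‖ / r) / (‖u - r‖ ^ 2 * (‖u - r‖ / r) ^ 2) := by
        gcongr
    _ = 2 * (1 - r ^ 2) / ‖u - r‖ ^ 3 := by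
        field_simp

theorem integral_poisson_circle {r : ℝ} (hr0 : 0 < r) (hr1 : r < 1) :
    ∫ θ in (0 : ℝ)..(2 * Real.pi), (1 - r ^ 2) / ‖circleMap 0 1 θ - r‖ ^ 2 = 2 * Real.pi := by
  have h := DiffContOnCl.circleAverage_poissonKernel_smul' (f := fun _ : ℂ => (1 : ℂ))
    (c := 0) (R := 1) (w := (r : ℂ)) diffContOnCl_const
    (by simpa [abs_of_pos hr0] using hr1)
  rw [Real.circleAverage_def] at h
  have e : ∀ θ : ℝ, ((‖circleMap 0 1 θ - 0‖ ^ 2 - ‖(r : ℂ) - 0‖ ^ 2) /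
      ‖(circleMap 0 1 θ - 0) - ((r : ℂ) - 0)‖ ^ 2) • (1 : ℂ) =
      (((1 - r ^ 2) / ‖circleMap 0 1 θ - r‖ ^ 2 : ℝ) : ℂ) := by
    intro θ
    simp
  simp_rw [e] at h
  rw [intervalIntegral.integral_ofReal, Complex.real_smul] at h
  have h' : (2 * Real.pi)⁻¹ * ∫ θ in (0 : ℝ)..(2 * Real.pi),
      (1 - r ^ 2) / ‖circleMap 0 1 θ - r‖ ^ 2 = 1 := by exact_mod_cast h
  have hpi := Real.pi_pos
  field_simp at h'
  linarith

/-- The reflected kernel is holomorphic in the disc and integrates to zero against `G`, so the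
difference of the kernels still represents `deriv G r`. The linear part of the bound meets a Poisson
kernel; the cubic part leaves a multiple of `1 - r²`. -/
theorem norm_deriv_le_of_boundary_bound {G : ℂ → ℂ} (hG : DiffContOnCl ℂ G (ball 0 1))
    {ε M : ℝ} (hε : 0 ≤ ε) (hM : 0 ≤ M)
    (hb : ∀ u : ℂ, ‖u‖ = 1 → ‖G u‖ ≤ ε * ‖u - 1‖ + M * ‖u - 1‖ ^ 3)
    {r : ℝ} (hr0 : 0 < r) (hr1 : r < 1) :
    ‖deriv G r‖ ≤ 4 * ε + 16 * M * (1 - r ^ 2) := by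
  have hpi := Real.pi_pos
  have hr2 : 0 < 1 - r ^ 2 := by nlinarith
  have hrb : (r : ℂ) ∈ ball (0 : ℂ) 1 := by simpa [abs_of_pos hr0] using hr1
  have hne : ∀ u ∈ sphere (0 : ℂ) 1, u - r ≠ 0 := by
    intro u hu h
    rw [sub_eq_zero.1 h] at hu
    rw [mem_ball_zero_iff] at hrb
    rw [mem_sphere_zero_iff_norm] at hu
    linarith
  have hne' : ∀ u ∈ closedBall (0 : ℂ) 1, u - (r : ℂ)⁻¹ ≠ 0 := by
    intro u hu h
    rw [sub_eq_zero.1 h, mem_closedBall_zero_iff, norm_inv, Complex.norm_real,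
      Real.norm_of_nonneg hr0.le] at hu
    have := (one_lt_inv₀ hr0).2 hr1
    linarith
  have h1 := hG.circleIntegral_sub_inv_sq_mul hrb
  have h2 : ∮ u in C(0, 1), (u - (r : ℂ)⁻¹)⁻¹ ^ 2 * G u = 0 := by
    refine DiffContOnCl.circleIntegral_eq_zero zero_le_one ?_
    have hd : DiffContOnCl ℂ (fun u : ℂ => (u - (r : ℂ)⁻¹)⁻¹) (ball 0 1) := by
      refine DiffContOnCl.inv (Differentiable.diffContOnCl (by fun_prop)) ?_
      rw [closure_ball _ one_ne_zero]
      exact hne'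
    simpa only [smul_eq_mul, pow_two, mul_assoc] using hd.smul (hd.smul hG)
  have hGs := hG.continuousOn_ball.mono sphere_subset_closedBall
  have c1 : ContinuousOn (fun u : ℂ => (u - r)⁻¹ ^ 2 * G u) (sphere 0 1) :=
    (((continuousOn_id.sub continuousOn_const).inv₀ hne).pow 2).mul hGs
  have c2 : ContinuousOn (fun u : ℂ => (u - (r : ℂ)⁻¹)⁻¹ ^ 2 * G u) (sphere 0 1) :=
    (((continuousOn_id.sub continuousOn_const).inv₀
      fun u hu => hne' u (sphere_subset_closedBall hu)).pow 2).mul hGs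
  have h3 := circleIntegral.integral_sub
    (c1.circleIntegrable zero_le_one) (c2.circleIntegrable zero_le_one)
  rw [h2, sub_zero] at h3
  rw [← h3] at h1
  have hcont : Continuous fun θ : ℝ => (1 - r ^ 2) / ‖circleMap 0 1 θ - r‖ ^ 2 := by
    refine continuous_const.div (((continuous_circleMap 0 1).sub continuous_const).norm.pow 2) ?_
    intro θ
    exact pow_ne_zero _ (norm_ne_zero_iff.2 (hne _ (by simp)))
  have h4 : ‖∮ u in C(0, 1), ((u - r)⁻¹ ^ 2 * G u - (u - (r : ℂ)⁻¹)⁻¹ ^ 2 * G u)‖ ≤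
      ∫ θ in (0 : ℝ)..(2 * Real.pi), (4 * ε * ((1 - r ^ 2) / ‖circleMap 0 1 θ - r‖ ^ 2) +
        16 * M * (1 - r ^ 2)) := by
    refine intervalIntegral.norm_integral_le_of_norm_le (by positivity) ?_
      (((continuous_const.mul hcont).add continuous_const).intervalIntegrable _ _)
    refine ae_of_all _ fun θ _ => ?_
    set u := circleMap 0 1 θ with hu
    have hu1 : ‖u‖ = 1 := by simp [hu]
    have hp : 0 < ‖u - r‖ := norm_pos_iff.2 (hne _ (by simp [hu]))
    rw [norm_smul, deriv_circleMap, norm_mul, Complex.norm_I, ← hu, hu1, mul_one, one_mul]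
    beta_reduce
    rw [← sub_mul, norm_mul]
    -- Since `1 - r ≤ ‖u - r‖`. With the factor `2` of the kernel bound this produces the constants
    -- `4 = 2 * 2` and `16 = 2 * 2³`.
    have hle : ‖u - 1‖ ≤ 2 * ‖u - r‖ := by
      have t1 : ‖u - 1‖ ≤ ‖u - r‖ + ‖(r : ℂ) - 1‖ := by
        simpa using norm_add_le (u - r) ((r : ℂ) - 1)
      have t2 : ‖(r : ℂ) - 1‖ = 1 - r := by
        rw [← Complex.ofReal_one, ← Complex.ofReal_sub, Complex.norm_real, ← norm_neg,
          Real.norm_of_nonneg] <;> linarith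
      have t3 : 1 - r ≤ ‖u - r‖ := by
        have := norm_sub_norm_le u (r : ℂ)
        rwa [hu1, Complex.norm_real, Real.norm_of_nonneg hr0.le] at this
      linarith
    calc ‖(u - r)⁻¹ ^ 2 - (u - (r : ℂ)⁻¹)⁻¹ ^ 2‖ * ‖G u‖
        ≤ (2 * (1 - r ^ 2) / ‖u - r‖ ^ 3) * (ε * (2 * ‖u - r‖) + M * (2 * ‖u - r‖) ^ 3) := by
          refine mul_le_mul (norm_reflected_kernel_le hr0 hr1 hu1) ((hb u hu1).trans ?_)
            (norm_nonneg _) (by positivity)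
          gcongr
      _ = 4 * ε * ((1 - r ^ 2) / ‖u - r‖ ^ 2) + 16 * M * (1 - r ^ 2) := by
          field_simp
          ring
  have hcont' : Continuous fun θ : ℝ => 4 * ε * ((1 - r ^ 2) / ‖circleMap 0 1 θ - r‖ ^ 2) :=
    continuous_const.mul hcont
  rw [h1, intervalIntegral.integral_add (hcont'.intervalIntegrable _ _)
    (continuous_const.intervalIntegrable _ _), intervalIntegral.integral_const_mul,
    integral_poisson_circle hr0 hr1, intervalIntegral.integral_const] at h4
  have h5 : ‖(2 * (Real.pi : ℂ) * Complex.I)‖ = 2 * Real.pi := by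
    simp [abs_of_pos hpi]
  rw [norm_mul, h5, sub_zero, smul_eq_mul] at h4
  have : 2 * Real.pi * ‖deriv G r‖ ≤ 2 * Real.pi * (4 * ε + 16 * M * (1 - r ^ 2)) := by
    linarith
  exact le_of_mul_le_mul_left this (by positivity)

/-- Changes the parameter from the angle to the point: on the circle `u.arg * I = log u = (u - 1) +
o(u - 1)`. -/
theorem isLittleO_of_hasDerivAt_circle {F : ℂ → ℂ} {D : ℂ}
    (hD : HasDerivAt (fun θ : ℝ => F (Complex.exp (θ * Complex.I))) D 0) :
    (fun u => F u - F 1 - (D / Complex.I) * (u - 1)) =o[𝓝[sphere 0 1] (1 : ℂ)]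
      fun u => u - 1 := by
  have hlog := Complex.hasDerivAt_log (Complex.one_mem_slitPlane)
  have hO : (fun u => Complex.log u) =O[𝓝 (1 : ℂ)] fun u => u - 1 := by
    have := hlog.isBigO_sub
    simpa using this
  have ho : (fun u => Complex.log u - (u - 1)) =o[𝓝 (1 : ℂ)] fun u => u - 1 := by
    have := hasDerivAt_iff_isLittleO.1 hlog
    simpa using this
  have harg : (fun u : ℂ => u.arg) =O[𝓝 (1 : ℂ)] fun u => u - 1 := by
    refine (Asymptotics.isBigO_of_le _ fun u => ?_).trans hO
    rw [← Complex.log_im]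
    exact Complex.abs_im_le_norm _
  have harg0 : Tendsto (fun u : ℂ => u.arg) (𝓝 1) (𝓝 0) := by
    have := Complex.continuousAt_arg Complex.one_mem_slitPlane
    simpa [ContinuousAt] using this
  have h1 : (fun u : ℂ => F (Complex.exp (u.arg * Complex.I)) - F 1 - u.arg * D)
      =o[𝓝 (1 : ℂ)] fun u => u - 1 := by
    have := (hasDerivAt_iff_isLittleO.1 hD).comp_tendsto harg0
    have h2 := this.trans_isBigO (by simpa [Function.comp_def] using harg)
    simpa [Function.comp_def] using h2
  have h3 : (fun u : ℂ => (D / Complex.I) * (Complex.log u - (u - 1)))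
      =o[𝓝 (1 : ℂ)] fun u => u - 1 := ho.const_mul_left _
  refine ((h1.add h3).mono nhdsWithin_le_nhds).congr' ?_ EventuallyEq.rfl
  filter_upwards [self_mem_nhdsWithin] with u hu
  have hu1 : ‖u‖ = 1 := by simpa using hu
  have e1 : Complex.exp (u.arg * Complex.I) = u := by
    have := Complex.norm_mul_exp_arg_mul_I u
    rwa [hu1, Complex.ofReal_one, one_mul] at this
  have e2 : Complex.log u = u.arg * Complex.I := by
    rw [Complex.log, hu1]; simp
  rw [e1, e2]
  field_simp
  ring

/-- After subtracting the first-order expansion at `1`, the remainder is at most `ε ‖u - 1‖` near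
`1` and bounded elsewhere, so `norm_deriv_le_of_boundary_bound` makes its radial derivative small.
-/
theorem tendsto_deriv_of_hasDerivAt_circle {F : ℂ → ℂ} {D : ℂ}
    (hF : DiffContOnCl ℂ F (ball 0 1))
    (hD : HasDerivAt (fun θ : ℝ => F (Complex.exp (θ * Complex.I))) D 0) :
    Tendsto (fun r : ℝ => deriv F r) (𝓝[<] 1) (𝓝 (D / Complex.I)) := by
  set a := D / Complex.I with ha
  set G : ℂ → ℂ := fun u => F u - F 1 - a * (u - 1) with hG
  have hGd : DiffContOnCl ℂ G (ball 0 1) :=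
    (hF.sub diffContOnCl_const).sub (Differentiable.diffContOnCl (by fun_prop))
  have hGo := isLittleO_of_hasDerivAt_circle hD
  obtain ⟨B, hB⟩ := (isCompact_sphere (0 : ℂ) 1).exists_bound_of_continuousOn
    (hGd.continuousOn_ball.mono sphere_subset_closedBall)
  rw [Metric.tendsto_nhds]
  intro e he
  have h1 := (Asymptotics.isLittleO_iff.1 hGo) (show (0 : ℝ) < e / 8 by positivity)
  obtain ⟨δ, hδ, h2⟩ := Metric.mem_nhdsWithin_iff.1 h1
  -- Chosen so that the cubic term absorbs the crude bound `B` wherever `‖u - 1‖ ≥ δ`.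
  set M := max B 0 / δ ^ 3 with hM
  have hM0 : 0 ≤ M := by positivity
  have hb : ∀ u : ℂ, ‖u‖ = 1 → ‖G u‖ ≤ e / 8 * ‖u - 1‖ + M * ‖u - 1‖ ^ 3 := by
    intro u hu
    by_cases h : dist u 1 < δ
    · have : ‖G u‖ ≤ e / 8 * ‖u - 1‖ := h2 ⟨h, by simpa using hu⟩
      have : 0 ≤ M * ‖u - 1‖ ^ 3 := by positivity
      linarith
    · rw [dist_eq_norm, not_lt] at h
      have h3 : max B 0 ≤ M * ‖u - 1‖ ^ 3 := by
        rw [hM, div_mul_eq_mul_div, le_div_iff₀ (by positivity)]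
        gcongr
      have h4 := hB u (by simpa using hu)
      have : 0 ≤ e / 8 * ‖u - 1‖ := by positivity
      linarith [le_max_left B 0]
  have h5 : Tendsto (fun r : ℝ => 16 * M * (1 - r ^ 2)) (𝓝[<] 1) (𝓝 0) := by
    have : Tendsto (fun r : ℝ => 16 * M * (1 - r ^ 2)) (𝓝 1) (𝓝 (16 * M * (1 - 1 ^ 2))) :=
      Continuous.tendsto (by fun_prop) 1
    simpa using this.mono_left nhdsWithin_le_nhds
  filter_upwards [h5.eventually (gt_mem_nhds (show (0 : ℝ) < e / 2 by positivity)),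
    Ioo_mem_nhdsLT (show (0 : ℝ) < 1 by norm_num)] with r hr hr01
  have h6 := norm_deriv_le_of_boundary_bound hGd (by positivity) hM0 hb hr01.1 hr01.2
  have hrb : (r : ℂ) ∈ ball (0 : ℂ) 1 := by simpa [abs_of_pos hr01.1] using hr01.2
  have h7 : deriv G r = deriv F r - a := by
    have hF' := (hF.differentiableAt isOpen_ball hrb).hasDerivAt
    have hl : HasDerivAt (fun u : ℂ => a * (u - 1)) a (r : ℂ) := by
      simpa using ((hasDerivAt_id (r : ℂ)).sub_const 1).const_mul a
    exact ((hF'.sub_const (F 1)).sub hl).deriv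
  rw [dist_eq_norm, ← h7]
  linarith

/-- Fatou's theorem on radial limits of bounded holomorphic functions in the unit disc. -/
theorem ae_exists_radialLimit_circle {f : ℂ → ℂ} (hf : DifferentiableOn ℂ f (ball 0 1)) {K : ℝ≥0}
    (hb : ∀ z ∈ ball (0 : ℂ) 1, ‖f z‖₊ ≤ K) :
    ∀ᵐ θ : ℝ, ∃ l, Tendsto (fun r : ℝ => f (r * circleMap 0 1 θ)) (𝓝[<] 1) (𝓝 l) := by
  -- A primitive of a bounded function is Lipschitz and extends to a Lipschitz function on the
  -- plane. On the circle it is differentiable at almost every angle, and at such an angle its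
  -- radial derivative, hence `f`, has a limit.
  obtain ⟨F₀, hF₀⟩ := hf.isExactOn_ball
  have hL : LipschitzOnWith K F₀ (ball 0 1) :=
    (convex_ball _ _).lipschitzOnWith_of_nnnorm_hasDerivWithin_le
      (fun z hz => (hF₀ z hz).hasDerivWithinAt) hb
  obtain ⟨F, hFL, hFe⟩ := hL.extend_finite_dimension
  have hFd : ∀ z ∈ ball (0 : ℂ) 1, HasDerivAt F (f z) z := fun z hz =>
    (hF₀ z hz).congr_of_eventuallyEq (hFe.symm.eventuallyEq_of_mem (isOpen_ball.mem_nhds hz))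
  have hlip := hFL.comp (lipschitzWith_circleMap 0 1)
  filter_upwards [hlip.ae_differentiableAt_real] with θ hθ
  set ζ := circleMap 0 1 θ with hζ
  have hζ1 : ‖ζ‖ = 1 := by simp [hζ]
  have hmem : ∀ z ∈ ball (0 : ℂ) 1, z * ζ ∈ ball (0 : ℂ) 1 := by
    intro z hz; simpa [hζ1] using hz
  have hD2 : ∀ z ∈ ball (0 : ℂ) 1, HasDerivAt (fun z => F (z * ζ)) (f (z * ζ) * ζ) z := by
    intro z hz
    have h1 : HasDerivAt (fun z : ℂ => z * ζ) ζ z := by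
      simpa using (hasDerivAt_id z).mul_const ζ
    exact (hFd _ (hmem z hz)).comp z h1
  have hdc : DiffContOnCl ℂ (fun z => F (z * ζ)) (ball 0 1) :=
    ⟨fun z hz => (hD2 z hz).differentiableAt.differentiableWithinAt,
      (hFL.continuous.comp (continuous_id.mul continuous_const)).continuousOn⟩
  have hcirc : HasDerivAt (fun t : ℝ => F (Complex.exp (t * Complex.I) * ζ))
      (deriv (F ∘ circleMap 0 1) θ) 0 := by
    have h1 : HasDerivAt (F ∘ circleMap 0 1) (deriv (F ∘ circleMap 0 1) θ) (0 + θ) := by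
      rw [zero_add]; exact hθ.hasDerivAt
    have h2 := h1.comp_add_const 0 θ
    have e : (fun t : ℝ => F (Complex.exp (t * Complex.I) * ζ)) =
        fun t => (F ∘ circleMap 0 1) (t + θ) := by
      funext t
      simp only [Function.comp, hζ, circleMap, zero_add, Complex.ofReal_one, one_mul,
        Complex.ofReal_add, add_mul, Complex.exp_add]
    rw [e]
    exact h2
  have h3 := tendsto_deriv_of_hasDerivAt_circle hdc hcirc
  refine ⟨deriv (F ∘ circleMap 0 1) θ / Complex.I * ζ⁻¹, ?_⟩
  refine (h3.mul_const ζ⁻¹).congr' ?_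
  filter_upwards [Ioo_mem_nhdsLT (show (0 : ℝ) < 1 by norm_num)] with r hr
  have hrb : (r : ℂ) ∈ ball (0 : ℂ) 1 := by simpa [abs_of_pos hr.1] using hr.2
  have hζ0 : ζ ≠ 0 := by rw [← norm_pos_iff, hζ1]; norm_num
  rw [(hD2 _ hrb).deriv, mul_inv_cancel_right₀ hζ0]

/-! ### Radial limits in the ball and measurable boundary values. -/

theorem measurable_indicator_ball {d : ℕ} {b : CSpace d → ℂ} (hb : ContinuousOn b (ball 0 1)) :
    Measurable ((ball (0 : CSpace d) 1).indicator b) := by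
  classical
  have := hb.measurable_piecewise (g := fun _ => (0 : ℂ)) continuousOn_const measurableSet_ball
  rwa [show (fun _ : CSpace d => (0 : ℂ)) = 0 from rfl, piecewise_eq_indicator] at this

theorem ofReal_smul_mem_ball {d : ℕ} {ζ : CSpace d} (hζ : ‖ζ‖ ≤ 1) {r : ℝ} (hr : r ∈ Ioo (0 : ℝ) 1) :
    (r : ℂ) • ζ ∈ ball (0 : CSpace d) 1 := by
  rw [mem_ball_zero_iff, norm_smul, Complex.norm_real, Real.norm_of_nonneg hr.1.le]
  nlinarith [hr.1, hr.2, norm_nonneg ζ]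

/-- Rational radii make the set where the limit exists measurable, by countability; continuity
recovers all radii. -/
theorem tendsto_nhdsLT_of_tendsto_rat {u : ℝ → ℂ} (hu : ContinuousOn u (Ioo 0 1)) {l : ℂ}
    (h : Tendsto (fun q : ℚ => u q) (comap ((↑) : ℚ → ℝ) (𝓝[<] 1)) (𝓝 l)) :
    Tendsto u (𝓝[<] 1) (𝓝 l) := by
  rw [(nhds_basis_closedBall (x := l)).tendsto_right_iff]
  intro ε hε
  obtain ⟨s, hs, hsub⟩ := mem_comap.1 (h (closedBall_mem_nhds l hε))
  obtain ⟨a, ha, has⟩ := (mem_nhdsLT_iff_exists_Ioo_subset).1 hs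
  filter_upwards [Ioo_mem_nhdsLT (show a < 1 from ha),
    Ioo_mem_nhdsLT (show (0 : ℝ) < 1 by norm_num)] with r hra hr
  by_contra hcon
  have hopen : ∀ᶠ x in 𝓝 r, u x ∈ (closedBall l ε)ᶜ :=
    (hu.continuousAt (isOpen_Ioo.mem_nhds hr)) (isClosed_closedBall.isOpen_compl.mem_nhds hcon)
  obtain ⟨V, hV, hVo, hrV⟩ :=
    _root_.mem_nhds_iff.1 (inter_mem hopen (isOpen_Ioo.mem_nhds hra))
  obtain ⟨q, hq⟩ := Rat.denseRange_cast.exists_mem_open hVo ⟨r, hrV⟩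
  exact (hV hq).1 (hsub (show (q : ℝ) ∈ s from has (hV hq).2))

/-- Fatou's theorem on radial limits of bounded holomorphic functions in the unit ball. -/
theorem ae_exists_hasRadialLimit {d : ℕ} (hd : 1 ≤ d) {b : CSpace d → ℂ}
    (hb : DifferentiableOn ℂ b (ball 0 1)) (hmap : MapsTo b (ball 0 1) (ball 0 1)) :
    ∀ᵐ ζ ∂(sphereMeasure d), ∃ l, HasRadialLimit b ζ l := by
  have := isProbabilityMeasure_sphereMeasure hd
  set b' := (ball (0 : CSpace d) 1).indicator b with hb'
  set L : Filter ℚ := comap ((↑) : ℚ → ℝ) (𝓝[<] 1) with hL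
  set E : Set (CSpace d) := {ζ | ∃ l, Tendsto (fun q : ℚ => b' (((q : ℝ) : ℂ) • ζ)) L (𝓝 l)}
    with hE
  have hEm : MeasurableSet E := by
    refine measurableSet_exists_tendsto fun q => ?_
    exact (measurable_indicator_ball hb.continuousOn).comp (measurable_const_smul _)
  have hbe : ∀ {ζ : CSpace d}, ‖ζ‖ = 1 → ∀ {r : ℝ}, r ∈ Ioo (0 : ℝ) 1 →
      b' ((r : ℂ) • ζ) = b ((r : ℂ) • ζ) := fun hζ _ hr =>
    indicator_of_mem (ofReal_smul_mem_ball hζ.le hr) _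
  have h01 : Ioo (0 : ℝ) 1 ∈ 𝓝[<] (1 : ℝ) := Ioo_mem_nhdsLT (by norm_num)
  have h1 : ∀ᵐ ζ ∂(sphereMeasure d), ∀ᵐ θ : ℝ, circleMap 0 1 θ • ζ ∈ E := by
    filter_upwards [ae_sphereMeasure_norm_eq] with ζ hζ
    have hslice : DifferentiableOn ℂ (fun u : ℂ => b (u • ζ)) (ball 0 1) := by
      refine hb.comp (g := b) (f := fun u : ℂ => u • ζ) (by fun_prop) ?_
      intro u hu
      simpa [norm_smul, hζ] using hu
    have hbd : ∀ z ∈ ball (0 : ℂ) 1, ‖b (z • ζ)‖₊ ≤ 1 := by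
      intro z hz
      have h2 : z • ζ ∈ ball (0 : CSpace d) 1 := by simpa [norm_smul, hζ] using hz
      have := hmap h2
      rw [mem_ball_zero_iff] at this
      exact_mod_cast this.le
    filter_upwards [ae_exists_radialLimit_circle hslice hbd] with θ hθ
    obtain ⟨l, hl⟩ := hθ
    refine ⟨l, (hl.comp tendsto_comap).congr' ?_⟩
    filter_upwards [preimage_mem_comap h01] with q hq
    rw [hbe (by simp [norm_smul, hζ]) hq, smul_smul]
    rfl
  -- Fatou's theorem on each complex line, with the quantifiers exchanged by Fubini. A single good
  -- `θ` is then enough, as the measure is invariant under multiplication by the phase.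
  have h2 : ∀ᵐ θ : ℝ, ∀ᵐ ζ ∂(sphereMeasure d), circleMap 0 1 θ • ζ ∈ E := by
    rwa [Measure.ae_ae_comm] at h1
    exact (continuous_circleMap_smul.comp continuous_swap).measurable hEm
  obtain ⟨θ, hθ⟩ := h2.exists
  have h3 : ∀ᵐ ζ ∂(sphereMeasure d), ζ ∈ E := by
    have hmp := measurePreserving_sphereMeasure
      (scalarRotation d (circleMap 0 1 θ) (norm_circleMap_zero_one θ))
    rw [← hmp.map_eq]
    exact (ae_map_iff hmp.measurable.aemeasurable hEm).2 hθ
  filter_upwards [h3, ae_sphereMeasure_norm_eq] with ζ hζ hζ1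
  obtain ⟨l, hl⟩ := hζ
  refine ⟨l, tendsto_nhdsLT_of_tendsto_rat ?_ (hl.congr' ?_)⟩
  · refine hb.continuousOn.comp (f := fun r : ℝ => (r : ℂ) • ζ) ?_ ?_
    · exact (Complex.continuous_ofReal.smul continuous_const).continuousOn
    · exact fun r hr => ofReal_smul_mem_ball hζ1.le hr
  · filter_upwards [preimage_mem_comap h01] with q hq
    exact hbe hζ1 hq

theorem HasRadialLimit.boundaryExtension_eq {d : ℕ} {f : CSpace d → ℂ} {ζ : CSpace d} {l : ℂ}
    (h : HasRadialLimit f ζ l) (hζ : ‖ζ‖ = 1) : boundaryExtension f ζ = l := by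
  rw [boundaryExtension, if_neg (by rw [hζ]; exact lt_irrefl _)]
  exact h.limUnder_eq

theorem HasRadialLimit.norm_le_one {d : ℕ} {b : CSpace d → ℂ}
    (hmap : MapsTo b (ball 0 1) (ball 0 1)) {ζ : CSpace d} {l : ℂ}
    (h : HasRadialLimit b ζ l) (hζ : ‖ζ‖ = 1) : ‖l‖ ≤ 1 := by
  refine le_of_tendsto h.norm ?_
  filter_upwards [Ioo_mem_nhdsLT (show (0 : ℝ) < 1 by norm_num)] with r hr
  have := hmap (ofReal_smul_mem_ball hζ.le hr)
  rw [mem_ball_zero_iff] at this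
  exact this.le

/-- `B` agrees with `b` at the point `z` of the open ball, or is the radial limit of `b` at the
point `z` of the sphere. -/
def IsBoundaryValue {d : ℕ} (b B : CSpace d → ℂ) (z : CSpace d) : Prop :=
  (‖z‖ < 1 ∧ B z = b z) ∨ (‖z‖ = 1 ∧ HasRadialLimit b z (B z))

/-- Radii increasing to `1`. -/
noncomputable def radius (n : ℕ) : ℝ := 1 - 1 / ((n : ℝ) + 2)

theorem radius_mem (n : ℕ) : radius n ∈ Ioo (0 : ℝ) 1 := by
  have h : (0 : ℝ) < (n : ℝ) + 2 := by positivity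
  constructor
  · rw [radius, sub_pos, div_lt_one h]
    have : (0 : ℝ) ≤ n := by positivity
    linarith
  · rw [radius]
    have : 0 < 1 / ((n : ℝ) + 2) := by positivity
    linarith

theorem tendsto_radius : Tendsto radius atTop (𝓝[<] 1) := by
  refine tendsto_nhdsWithin_iff.2 ⟨?_, Eventually.of_forall fun n => (radius_mem n).2⟩
  have h : Tendsto (fun n : ℕ => (1 : ℝ) / ((n : ℝ) + 2)) atTop (𝓝 0) := by
    refine Tendsto.div_atTop tendsto_const_nhds ?_
    exact tendsto_atTop_add_const_right _ _ tendsto_natCast_atTop_atTop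
  have := h.const_sub 1
  rwa [sub_zero] at this

/-- `boundaryExtension b` is an almost everywhere limit of measurable functions along the radii
`radius n`, hence merely almost everywhere measurable. A Borel version bounded by `1` everywhere
removes measurability and integrability concerns from later integrals. -/
theorem exists_measurable_boundaryValue {d : ℕ} {b : CSpace d → ℂ}
    (hb : DifferentiableOn ℂ b (ball 0 1)) (hmap : MapsTo b (ball 0 1) (ball 0 1))
    (ν : Measure (CSpace d)) (hν : ∀ᵐ z ∂ν, ‖z‖ ≤ 1)
    (hlim : ∀ᵐ z ∂ν, ‖z‖ = 1 → ∃ l, HasRadialLimit b z l) :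
    ∃ B : CSpace d → ℂ, Measurable B ∧ (∀ z, ‖B z‖ ≤ 1) ∧ ∀ᵐ z ∂ν, IsBoundaryValue b B z := by
  classical
  set b' := (ball (0 : CSpace d) 1).indicator b with hb'
  have hb'm : Measurable b' := measurable_indicator_ball hb.continuousOn
  have hball : MeasurableSet {z : CSpace d | ‖z‖ < 1} := measurableSet_lt measurable_norm
    measurable_const
  set f : ℕ → CSpace d → ℂ := fun n z => if ‖z‖ < 1 then b' z else b' ((radius n : ℂ) • z) with hf
  have hfm : ∀ n, Measurable (f n) := fun n =>
    Measurable.ite hball hb'm (hb'm.comp (measurable_const_smul _))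
  have hval : ∀ᵐ z ∂ν, IsBoundaryValue b (boundaryExtension b) z := by
    filter_upwards [hν, hlim] with z hz hl
    rcases hz.lt_or_eq with h | h
    · exact Or.inl ⟨h, by rw [boundaryExtension, if_pos h]⟩
    · obtain ⟨l, hl⟩ := hl h
      exact Or.inr ⟨h, by rw [hl.boundaryExtension_eq h]; exact hl⟩
  have hae : AEMeasurable (boundaryExtension b) ν := by
    refine aemeasurable_of_tendsto_metrizable_ae atTop (fun n => (hfm n).aemeasurable) ?_
    filter_upwards [hval] with z hz
    rcases hz with ⟨h, h2⟩ | ⟨h, h2⟩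
    · have : ∀ n, f n z = boundaryExtension b z := by
        intro n
        rw [h2]
        simp only [hf, if_pos h]
        exact indicator_of_mem (by simpa using h) _
      simp only [this]
      exact tendsto_const_nhds
    · refine (h2.comp tendsto_radius).congr fun n => ?_
      simp only [hf, h, lt_irrefl, if_false, Function.comp]
      exact (indicator_of_mem (ofReal_smul_mem_ball h.le (radius_mem n)) _).symm
  set B₀ := hae.mk _ with hB₀
  have hB₀m : Measurable B₀ := hae.measurable_mk
  -- The cut-off alters `B₀` only on a null set, since values and radial limits of `b` have modulus
  -- at most `1`.
  refine ⟨fun z => if ‖B₀ z‖ ≤ 1 then B₀ z else 0,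
    Measurable.ite (measurableSet_le hB₀m.norm measurable_const) hB₀m measurable_const, ?_, ?_⟩
  · intro z
    dsimp only
    split_ifs with h
    · exact h
    · simp
  · filter_upwards [hval, hae.ae_eq_mk] with z hz he
    rw [← hB₀] at he
    have hle : ‖boundaryExtension b z‖ ≤ 1 := by
      rcases hz with ⟨h, h2⟩ | ⟨h, h2⟩
      · rw [h2]
        have := hmap (show z ∈ ball 0 1 by simpa using h)
        rw [mem_ball_zero_iff] at this
        exact this.le
      · exact h2.norm_le_one hmap h
    have e : (if ‖B₀ z‖ ≤ 1 then B₀ z else 0) = boundaryExtension b z := by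
      rw [← he, if_pos hle]
    simpa only [IsBoundaryValue, e] using hz

/-! ### Positivity of the de Branges–Rovnyak kernel. -/

/-- The linear combination of Szegő kernels at points of the ball with coefficients `u`. -/
noncomputable def szegoSum {d : ℕ} (s : Finset (UnitBall d)) (u : UnitBall d → ℂ)
    (ζ : CSpace d) : ℂ :=
  ∑ x ∈ s, u x / (1 - inner ℂ (x : CSpace d) ζ) ^ d

theorem norm_unitBall_lt {d : ℕ} (x : UnitBall d) : ‖(x : CSpace d)‖ < 1 := by
  exact mem_ball_zero_iff.1 x.2

theorem diffContOnCl_szegoSum {d : ℕ} (s : Finset (UnitBall d)) (u : UnitBall d → ℂ) :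
    DiffContOnCl ℂ (szegoSum s u) (ball 0 1) := by
  classical
  unfold szegoSum
  induction s using Finset.induction_on with
  | empty => simpa using diffContOnCl_const
  | insert a s ha ih =>
    simp_rw [Finset.sum_insert ha]
    exact (diffContOnCl_div_one_sub_inner_pow diffContOnCl_const (norm_unitBall_lt a) d).add ih

theorem DiffContOnCl.continuousOn_sphere {d : ℕ} {g : CSpace d → ℂ}
    (hg : DiffContOnCl ℂ g (ball 0 1)) : ContinuousOn g (sphere 0 1) := by
  have := hg.continuousOn
  rw [closure_ball _ one_ne_zero] at this
  exact this.mono sphere_subset_closedBall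

theorem integral_conj_szegoSum_mul {d : ℕ} (hd : 1 ≤ d) (s : Finset (UnitBall d))
    (u : UnitBall d → ℂ) {g : CSpace d → ℂ} (hg : DiffContOnCl ℂ g (ball 0 1)) :
    ∫ ζ, conj (szegoSum s u ζ) * g ζ ∂(sphereMeasure d) = ∑ x ∈ s, conj (u x) * g x := by
  have e : ∀ ζ, conj (szegoSum s u ζ) * g ζ =
      ∑ x ∈ s, conj (u x) * (g ζ / (1 - inner ℂ ζ (x : CSpace d)) ^ d) := by
    intro ζ
    rw [szegoSum, map_sum, Finset.sum_mul]
    refine Finset.sum_congr rfl fun x _ => ?_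
    rw [map_div₀, map_pow, map_sub, map_one, inner_conj_symm]
    ring
  simp_rw [e]
  rw [integral_finsetSum]
  · refine Finset.sum_congr rfl fun x _ => ?_
    rw [integral_const_mul, integral_div_one_sub_inner_pow hd hg (norm_unitBall_lt x)]
  · intro x _
    refine Integrable.const_mul (ContinuousOn.integrable_sphereMeasure hd ?_) _
    refine hg.continuousOn_sphere.div ?_ ?_
    · exact ((continuous_const.sub (continuous_id.inner continuous_const)).pow d).continuousOn
    · intro ζ hζ
      exact pow_ne_zero _ (one_sub_inner_ne_zero (by simp at hζ; exact hζ.le) (norm_unitBall_lt x))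

/-- Multiplication by `f` is a contraction on the Hardy space, and its adjoint sends the Szegő
kernel at `y` to `conj (f y)` times itself, so it sends `H` to `U`. The form equals `‖H‖² - ‖U‖²` in
`L²(σ)`. -/
theorem re_sum_multiplier_kernel_nonneg {d : ℕ} (hd : 1 ≤ d) {f : CSpace d → ℂ}
    (hf : DiffContOnCl ℂ f (ball 0 1)) (hf1 : ∀ ζ ∈ sphere (0 : CSpace d) 1, ‖f ζ‖ ≤ 1)
    (s : Finset (UnitBall d)) (v : UnitBall d → ℂ) :
    0 ≤ (∑ x ∈ s, ∑ y ∈ s, v y * conj (v x) * ((1 - f x * conj (f y)) /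
      (1 - inner ℂ (y : CSpace d) (x : CSpace d)) ^ d)).re := by
  set u : UnitBall d → ℂ := fun y => v y * conj (f y) with hu
  set H := szegoSum s v with hH
  set U := szegoSum s u with hU
  have hHd := diffContOnCl_szegoSum s v
  have hUd := diffContOnCl_szegoSum s u
  rw [← hH] at hHd
  rw [← hU] at hUd
  have iH : Integrable (fun ζ => ‖H ζ‖ ^ 2) (sphereMeasure d) :=
    ContinuousOn.integrable_sphereMeasure hd (hHd.continuousOn_sphere.norm.pow 2)
  have iU : Integrable (fun ζ => ‖U ζ‖ ^ 2) (sphereMeasure d) :=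
    ContinuousOn.integrable_sphereMeasure hd (hUd.continuousOn_sphere.norm.pow 2)
  have nsq : ∀ {g : CSpace d → ℂ}, ∫ ζ, conj (g ζ) * g ζ ∂(sphereMeasure d) =
      ((∫ ζ, ‖g ζ‖ ^ 2 ∂(sphereMeasure d) : ℝ) : ℂ) := by
    intro g
    rw [← integral_complex_ofReal]
    refine integral_congr_ae (ae_of_all _ fun ζ => ?_)
    simp only [Complex.conj_mul', Complex.ofReal_pow]
  have h1 := integral_conj_szegoSum_mul hd s v hHd
  rw [← hH, nsq] at h1
  have h2 := integral_conj_szegoSum_mul hd s u hUd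
  rw [← hU, nsq] at h2
  have hfU : DiffContOnCl ℂ (fun ζ => f ζ * U ζ) (ball 0 1) := by
    simpa only [smul_eq_mul] using hf.smul hUd
  have h3 := integral_conj_szegoSum_mul hd s v hfU
  rw [← hH] at h3
  have h4 : ∑ x ∈ s, conj (u x) * U x = ∑ x ∈ s, conj (v x) * (f x * U x) := by
    refine Finset.sum_congr rfl fun x _ => ?_
    simp only [hu, map_mul, Complex.conj_conj]
    ring
  -- `‖U‖²` is the pairing of `f U` with `H`, hence at most `(‖H‖² + ‖U‖²) / 2`.
  have h5 : ∫ ζ, ‖U ζ‖ ^ 2 ∂(sphereMeasure d) ≤ ∫ ζ, ‖H ζ‖ ^ 2 ∂(sphereMeasure d) := by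
    have e1 : ∫ ζ, ‖U ζ‖ ^ 2 ∂(sphereMeasure d) =
        ‖∫ ζ, conj (H ζ) * (f ζ * U ζ) ∂(sphereMeasure d)‖ := by
      rw [h3, ← h4, ← h2, Complex.norm_real, Real.norm_of_nonneg]
      exact integral_nonneg fun ζ => by positivity
    have e2 : ‖∫ ζ, conj (H ζ) * (f ζ * U ζ) ∂(sphereMeasure d)‖ ≤
        ∫ ζ, (‖H ζ‖ ^ 2 + ‖U ζ‖ ^ 2) / 2 ∂(sphereMeasure d) := by
      refine norm_integral_le_of_norm_le ((iH.add iU).div_const 2) ?_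
      filter_upwards [ae_sphereMeasure_norm_eq] with ζ hζ
      rw [norm_mul, norm_mul, RCLike.norm_conj]
      have hfz := hf1 ζ (by simpa using hζ)
      have : ‖H ζ‖ * (‖f ζ‖ * ‖U ζ‖) ≤ ‖H ζ‖ * ‖U ζ‖ := by
        refine mul_le_mul_of_nonneg_left ?_ (norm_nonneg _)
        nlinarith [norm_nonneg (U ζ)]
      nlinarith [sq_nonneg (‖H ζ‖ - ‖U ζ‖)]
    rw [integral_div, integral_add iH iU] at e2
    linarith
  have h6 : ∑ x ∈ s, ∑ y ∈ s, v y * conj (v x) * ((1 - f x * conj (f y)) /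
      (1 - inner ℂ (y : CSpace d) (x : CSpace d)) ^ d) =
      ((∫ ζ, ‖H ζ‖ ^ 2 ∂(sphereMeasure d) - ∫ ζ, ‖U ζ‖ ^ 2 ∂(sphereMeasure d) : ℝ) : ℂ) := by
    rw [Complex.ofReal_sub, h1, h2, ← Finset.sum_sub_distrib]
    refine Finset.sum_congr rfl fun x _ => ?_
    rw [hH, hU, szegoSum, szegoSum, Finset.mul_sum, Finset.mul_sum, ← Finset.sum_sub_distrib]
    refine Finset.sum_congr rfl fun y _ => ?_
    simp only [hu, map_mul, Complex.conj_conj]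
    ring
  rw [h6, Complex.ofReal_re]
  linarith

theorem diffContOnCl_dilation {d : ℕ} {b : CSpace d → ℂ} (hb : DifferentiableOn ℂ b (ball 0 1))
    {r : ℝ} (hr : r ∈ Ioo (0 : ℝ) 1) :
    DiffContOnCl ℂ (fun z => b ((r : ℂ) • z)) (ball 0 1) := by
  have h : DifferentiableOn ℂ (fun z => b ((r : ℂ) • z)) (closure (ball 0 1)) := by
    refine hb.comp (g := b) (f := fun z : CSpace d => (r : ℂ) • z) (by fun_prop) ?_
    intro z hz
    rw [closure_ball _ one_ne_zero, mem_closedBall_zero_iff] at hz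
    exact ofReal_smul_mem_ball hz hr
  exact h.diffContOnCl

/-- The dilates `b (r ·)` are continuous up to the sphere and give nonnegative forms; for finitely
many points these converge as `r → 1`. -/
theorem posSemidef_dbrKernel {d : ℕ} (hd : 1 ≤ d) {b : CSpace d → ℂ}
    (hb : DifferentiableOn ℂ b (ball 0 1)) (hmap : MapsTo b (ball 0 1) (ball 0 1)) :
    (dbrKernel b).PosSemidef := by
  have key := (RKHS.posSemidef_tfae (K := dbrKernel b)).out 0 2
  rw [key]
  refine ⟨?_, fun v => ?_⟩
  · ext1 x y
    rw [Matrix.conjTranspose_apply]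
    simp only [dbrKernel, Matrix.of_apply, star_smul]
    rw [ContinuousLinearMap.star_eq_adjoint, ContinuousLinearMap.adjoint_id]
    congr 1
    simp only [RCLike.star_def, map_div₀, map_sub, map_one, map_mul, Complex.conj_conj, map_pow,
      inner_conj_symm]
    ring
  · have e : (v.sum fun x w => v.sum fun x' w' => inner ℂ (dbrKernel b x' x w) w') =
        ∑ x ∈ v.support, ∑ y ∈ v.support, v y * conj (v x) * ((1 - b x * conj (b y)) /
          (1 - inner ℂ (y : CSpace d) (x : CSpace d)) ^ d) := by
      refine Finset.sum_congr rfl fun x _ => Finset.sum_congr rfl fun y _ => ?_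
      simp only [dbrKernel, Matrix.of_apply, _root_.smul_apply,
        ContinuousLinearMap.id_apply, smul_eq_mul, RCLike.inner_apply, map_mul, map_div₀, map_sub,
        map_one, map_pow, Complex.conj_conj, inner_conj_symm]
      ring
    rw [e]
    have hlim : Tendsto (fun r : ℝ => (∑ x ∈ v.support, ∑ y ∈ v.support, v y * conj (v x) *
        ((1 - b ((r : ℂ) • (x : CSpace d)) * conj (b ((r : ℂ) • (y : CSpace d)))) /
          (1 - inner ℂ (y : CSpace d) (x : CSpace d)) ^ d)).re) (𝓝[<] 1)
        (𝓝 (∑ x ∈ v.support, ∑ y ∈ v.support, v y * conj (v x) * ((1 - b x * conj (b y)) /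
          (1 - inner ℂ (y : CSpace d) (x : CSpace d)) ^ d)).re) := by
      have hbx : ∀ x : UnitBall d,
          Tendsto (fun r : ℝ => b ((r : ℂ) • (x : CSpace d))) (𝓝[<] 1) (𝓝 (b x)) := by
        intro x
        have h1 : Tendsto (fun r : ℝ => (r : ℂ) • (x : CSpace d)) (𝓝[<] 1) (𝓝 x) := by
          have : Tendsto (fun r : ℝ => (r : ℂ) • (x : CSpace d)) (𝓝 1)
              (𝓝 (((1 : ℝ) : ℂ) • (x : CSpace d))) :=
            (Complex.continuous_ofReal.smul continuous_const).tendsto 1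
          rw [Complex.ofReal_one, one_smul] at this
          exact this.mono_left nhdsWithin_le_nhds
        exact ((hb.continuousOn.continuousAt (isOpen_ball.mem_nhds x.2)).tendsto).comp h1
      refine (Complex.continuous_re.tendsto _).comp ?_
      refine tendsto_finsetSum _ fun x _ => tendsto_finsetSum _ fun y _ => ?_
      refine Tendsto.const_mul _ (Tendsto.div_const (Tendsto.const_sub _ ?_) _)
      exact (hbx x).mul ((Complex.continuous_conj.tendsto _).comp (hbx y))
    refine ge_of_tendsto hlim ?_
    filter_upwards [Ioo_mem_nhdsLT (show (0 : ℝ) < 1 by norm_num)] with r hr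
    refine re_sum_multiplier_kernel_nonneg hd (diffContOnCl_dilation hb hr) ?_ v.support v
    intro ζ hζ
    exact (mem_ball_zero_iff.1 (hmap (ofReal_smul_mem_ball (by simp at hζ; exact hζ.le) hr))).le

/-! ### The kernel functions of `H(b)` as test functions. -/

theorem dbrPosKernel_eq {d : ℕ} (hd : 1 ≤ d) {b : CSpace d → ℂ}
    (hb : DifferentiableOn ℂ b (ball 0 1)) (hmap : MapsTo b (ball 0 1) (ball 0 1)) :
    dbrPosKernel b = dbrKernel b := by
  rw [dbrPosKernel, if_pos (posSemidef_dbrKernel hd hb hmap)]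

/-- The kernel function of `H(b)` at the point `w` of the ball. -/
noncomputable def kernelFunction {d : ℕ} (b : CSpace d → ℂ) (w : UnitBall d) :
    DeBrangesRovnyak b :=
  RKHS.kerFun (DeBrangesRovnyak b) w (1 : ℂ)

theorem kernelFunction_toFun {d : ℕ} (hd : 1 ≤ d) {b : CSpace d → ℂ}
    (hb : DifferentiableOn ℂ b (ball 0 1)) (hmap : MapsTo b (ball 0 1) (ball 0 1))
    (w : UnitBall d) {z : CSpace d} (hz : ‖z‖ < 1) :
    (kernelFunction b w).toFun z =
      (1 - b z * conj (b w)) / (1 - inner ℂ (w : CSpace d) z) ^ d := by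
  have hz' : z ∈ ball (0 : CSpace d) 1 := by simpa using hz
  rw [DeBrangesRovnyak.toFun, dif_pos hz', kernelFunction, RKHS.kerFun_apply,
    RKHS.OfKernel.kernel_ofKernel, dbrPosKernel_eq hd hb hmap]
  simp [dbrKernel]

theorem norm_sq_kernelFunction {d : ℕ} (hd : 1 ≤ d) {b : CSpace d → ℂ}
    (hb : DifferentiableOn ℂ b (ball 0 1)) (hmap : MapsTo b (ball 0 1) (ball 0 1))
    (w : UnitBall d) :
    ‖kernelFunction b w‖ ^ 2 = (1 - ‖b w‖ ^ 2) / (1 - ‖(w : CSpace d)‖ ^ 2) ^ d := by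
  have h1 : inner ℂ (kernelFunction b w) (kernelFunction b w) =
      (((1 - ‖b w‖ ^ 2) / (1 - ‖(w : CSpace d)‖ ^ 2) ^ d : ℝ) : ℂ) := by
    conv_lhs => rw [kernelFunction, RKHS.kerFun_inner, RKHS.kerFun_apply,
      RKHS.OfKernel.kernel_ofKernel, dbrPosKernel_eq hd hb hmap]
    simp [dbrKernel, inner_self_eq_norm_sq_to_K, Complex.mul_conj']
  rw [inner_self_eq_norm_sq_to_K, RCLike.ofReal_eq_complex_ofReal, ← Complex.ofReal_pow] at h1
  exact Complex.ofReal_injective h1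

/-- For fixed `w` in the open ball the denominator has no zero on the closed ball, so the kernel
function has a radial limit wherever `b` has one. -/
theorem HasRadialLimit.kernelFunction {d : ℕ} (hd : 1 ≤ d) {b : CSpace d → ℂ}
    (hb : DifferentiableOn ℂ b (ball 0 1)) (hmap : MapsTo b (ball 0 1) (ball 0 1))
    (w : UnitBall d) {z : CSpace d} (hz : ‖z‖ = 1) {l : ℂ} (h : HasRadialLimit b z l) :
    HasRadialLimit (kernelFunction b w).toFun z
      ((1 - l * conj (b w)) / (1 - inner ℂ (w : CSpace d) z) ^ d) := by
  have h1 : Tendsto (fun r : ℝ => (1 - b ((r : ℂ) • z) * conj (b w)) /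
      (1 - inner ℂ (w : CSpace d) ((r : ℂ) • z)) ^ d) (𝓝[<] 1)
      (𝓝 ((1 - l * conj (b w)) / (1 - inner ℂ (w : CSpace d) z) ^ d)) := by
    refine Tendsto.div (Tendsto.const_sub _ (Tendsto.mul_const _ h)) ?_ ?_
    · refine Tendsto.pow (Tendsto.const_sub _ ?_) _
      have : Tendsto (fun r : ℝ => inner ℂ (w : CSpace d) ((r : ℂ) • z)) (𝓝 1)
          (𝓝 (inner ℂ (w : CSpace d) (((1 : ℝ) : ℂ) • z))) :=
        (continuous_const.inner (Complex.continuous_ofReal.smul continuous_const)).tendsto 1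
      rw [Complex.ofReal_one, one_smul] at this
      exact this.mono_left nhdsWithin_le_nhds
    · refine pow_ne_zero _ fun h0 => one_sub_inner_ne_zero hz.le (norm_unitBall_lt w) ?_
      rw [← inner_conj_symm, ← map_one conj, ← map_sub, h0, map_zero]
  refine h1.congr' ?_
  filter_upwards [Ioo_mem_nhdsLT (show (0 : ℝ) < 1 by norm_num)] with r hr
  have := ofReal_smul_mem_ball hz.le hr
  rw [kernelFunction_toFun hd hb hmap w (mem_ball_zero_iff.1 this)]

theorem isAdmissible_kernelFunction {d : ℕ} (hd : 1 ≤ d) {b : CSpace d → ℂ}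
    {μ : Measure (CSpace d)} (hb : IsAdmissible μ b) (hmap : MapsTo b (ball 0 1) (ball 0 1))
    (w : UnitBall d) : IsAdmissible μ (kernelFunction b w).toFun where
  holomorphic := by
    have h1 : DifferentiableOn ℂ (fun z => (1 - b z * conj (b w)) /
        (1 - inner ℂ (w : CSpace d) z) ^ d) (ball 0 1) := by
      have h2 : DifferentiableOn ℂ (fun z => 1 - b z * conj (b w)) (ball 0 1) := by
        have := hb.holomorphic
        fun_prop
      have h3 : DifferentiableOn ℂ (fun z : CSpace d => (1 - inner ℂ (w : CSpace d) z) ^ d)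
          (ball 0 1) := by
        have : Differentiable ℂ fun ζ : CSpace d => (inner ℂ (w : CSpace d) ζ : ℂ) :=
          (innerSL ℂ (w : CSpace d)).differentiable
        exact Differentiable.differentiableOn (by fun_prop)
      simp only [div_eq_mul_inv]
      refine h2.mul (h3.inv fun z hz => pow_ne_zero _ fun h0 => ?_)
      refine one_sub_inner_ne_zero (mem_ball_zero_iff.1 hz).le (norm_unitBall_lt w) ?_
      rw [← inner_conj_symm, ← map_one conj, ← map_sub, h0, map_zero]
    exact h1.congr fun z hz =>
      kernelFunction_toFun hd hb.holomorphic hmap w (mem_ball_zero_iff.1 hz)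
  radialLimit := by
    filter_upwards [hb.radialLimit, ae_restrict_mem isClosed_sphere.measurableSet] with z hz hz1
    obtain ⟨l, hl⟩ := hz
    exact ⟨_, hl.kernelFunction hd hb.holomorphic hmap w (by simpa using hz1)⟩

/-! ### The reverse Carleson inequality in terms of the Poisson–Szegő kernel. -/

theorem measurable_poissonSzego {d : ℕ} :
    Measurable fun p : CSpace d × CSpace d => poissonSzego p.1 p.2 := by
  unfold poissonSzego
  fun_prop

theorem norm_inner_le_mul {d : ℕ} {w z : CSpace d} (hz : ‖z‖ ≤ 1) :
    ‖(inner ℂ w z : ℂ)‖ ≤ ‖w‖ :=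
  (norm_inner_le_norm w z).trans (mul_le_of_le_one_right (norm_nonneg _) hz)

theorem one_sub_norm_le_norm_one_sub_inner {d : ℕ} {w z : CSpace d} (hz : ‖z‖ ≤ 1) :
    1 - ‖w‖ ≤ ‖1 - (inner ℂ w z : ℂ)‖ := by
  have h1 := norm_sub_norm_le (1 : ℂ) (inner ℂ w z)
  rw [norm_one] at h1
  linarith [norm_inner_le_mul (w := w) hz]

theorem poissonSzego_nonneg {d : ℕ} {w : CSpace d} (hw : ‖w‖ ≤ 1) (z : CSpace d) :
    0 ≤ poissonSzego w z := by
  unfold poissonSzego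
  have : 0 ≤ 1 - ‖w‖ ^ 2 := by nlinarith [norm_nonneg w]
  positivity

theorem poissonSzego_le {d : ℕ} {w z : CSpace d} (hw : ‖w‖ < 1) (hz : ‖z‖ ≤ 1) :
    poissonSzego w z ≤ 1 / (1 - ‖w‖) ^ (2 * d) := by
  unfold poissonSzego
  have h0 : 0 < 1 - ‖w‖ := by linarith
  have h1 := one_sub_norm_le_norm_one_sub_inner (w := w) hz
  have h2 : (1 - ‖w‖ ^ 2) ^ d ≤ 1 :=
    pow_le_one₀ (by nlinarith [norm_nonneg w]) (by nlinarith [norm_nonneg w])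
  gcongr

/-- The reverse Carleson inequality tested on the kernel function at `w`. -/
theorem IsReverseCarlesonWith.one_sub_norm_sq_le {d : ℕ} (hd : 1 ≤ d) {A : ℝ≥0} {b : CSpace d → ℂ}
    {μ : Measure (CSpace d)} [IsFiniteMeasure μ] (hμ : ∀ᵐ z ∂μ, ‖z‖ ≤ 1)
    (hb : IsAdmissible μ b) (hmap : MapsTo b (ball 0 1) (ball 0 1))
    (hA : IsReverseCarlesonWith A b μ) {B : CSpace d → ℂ} (hBm : Measurable B)
    (hB1 : ∀ z, ‖B z‖ ≤ 1) (hB : ∀ᵐ z ∂μ, IsBoundaryValue b B z) {w : CSpace d} (hw : ‖w‖ < 1) :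
    1 - ‖b w‖ ^ 2 ≤
      (A : ℝ) ^ 2 * ∫ z, ‖1 - B z * conj (b w)‖ ^ 2 * poissonSzego w z ∂μ := by
  set W : UnitBall d := ⟨w, by simpa using hw⟩ with hW
  set h : CSpace d → ℂ := fun z => (1 - B z * conj (b w)) / (1 - inner ℂ w z) ^ d with hh
  have hbw : ‖b w‖ ≤ 1 := (mem_ball_zero_iff.1 (hmap (show w ∈ ball 0 1 by simpa using hw))).le
  have h1 := hA _ (isAdmissible_kernelFunction hd hb hmap W)
  have h2 : boundaryExtension (kernelFunction b W).toFun =ᵐ[μ] h := by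
    filter_upwards [hB] with z hz
    rcases hz with ⟨hz, e⟩ | ⟨hz, e⟩
    · rw [boundaryExtension, if_pos hz, kernelFunction_toFun hd hb.holomorphic hmap W hz, hh]
      simp only [e, hW]
    · rw [(e.kernelFunction hd hb.holomorphic hmap W hz).boundaryExtension_eq hz]
  rw [eLpNorm_congr_ae h2] at h1
  have hhm : Measurable h := by
    simp only [hh]
    fun_prop
  have hbd : ∀ᵐ z ∂μ, ‖h z‖ ≤ 2 / (1 - ‖w‖) ^ d := by
    filter_upwards [hμ] with z hz
    simp only [hh]
    rw [norm_div, norm_pow]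
    have h0 : 0 < 1 - ‖w‖ := by linarith
    have := one_sub_norm_le_norm_one_sub_inner (w := w) hz
    have h3 : ‖1 - B z * conj (b w)‖ ≤ 2 := by
      refine (norm_sub_le _ _).trans ?_
      rw [norm_one, norm_mul, RCLike.norm_conj]
      nlinarith [hB1 z, norm_nonneg (B z), norm_nonneg (b w)]
    gcongr
  have hmem : MemLp h 2 μ := MemLp.of_bound hhm.aestronglyMeasurable _ hbd
  have h3 : ‖kernelFunction b W‖ ≤ A * (eLpNorm h 2 μ).toReal := by
    have := ENNReal.toReal_mono (ENNReal.mul_ne_top ENNReal.coe_ne_top hmem.eLpNorm_ne_top) h1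
    simpa using this
  have h4 : (eLpNorm h 2 μ).toReal ^ 2 = ∫ z, ‖h z‖ ^ 2 ∂μ := by
    rw [hmem.eLpNorm_eq_integral_rpow_norm two_ne_zero ENNReal.ofNat_ne_top,
      ENNReal.toReal_ofReal (by positivity)]
    simp only [ENNReal.toReal_ofNat, Real.rpow_two]
    rw [← Real.rpow_natCast, ← Real.rpow_mul (integral_nonneg fun _ => by positivity)]
    norm_num
  have h5 : ‖kernelFunction b W‖ ^ 2 ≤ (A : ℝ) ^ 2 * ∫ z, ‖h z‖ ^ 2 ∂μ := by
    rw [← h4, ← mul_pow]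
    gcongr
  -- Clearing the denominator `(1 - ‖w‖²) ^ d` of the norm supplies exactly the numerator of the
  -- Poisson–Szegő kernel.
  rw [norm_sq_kernelFunction hd hb.holomorphic hmap W, div_le_iff₀
    (pow_pos (by nlinarith [norm_nonneg w]) _), mul_assoc, ← integral_mul_const] at h5
  refine h5.trans (le_of_eq ?_)
  congr 1
  refine integral_congr_ae (ae_of_all _ fun z => ?_)
  simp only [hh, poissonSzego, norm_div, norm_pow, div_pow, hW]
  rw [← pow_mul, mul_comm d 2]
  ring

/-! ### The dilated Poisson–Szegő kernel. -/

/-- The kernel `poissonSzego (r ζ) z` with `r = radius n`, set to zero unless `ζ` lies on the unit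
sphere and `z` in the closed unit ball. -/
noncomputable def dilatedKernel {d : ℕ} (n : ℕ) (ζ z : CSpace d) : ℝ :=
  ({p : CSpace d × CSpace d | ‖p.1‖ = 1 ∧ ‖p.2‖ ≤ 1}.indicator
    fun p => poissonSzego ((radius n : ℂ) • p.1) p.2) (ζ, z)

theorem dilatedKernel_of_mem {d : ℕ} (n : ℕ) {ζ z : CSpace d} (hζ : ‖ζ‖ = 1) (hz : ‖z‖ ≤ 1) :
    dilatedKernel n ζ z = poissonSzego ((radius n : ℂ) • ζ) z :=
  indicator_of_mem (show (ζ, z) ∈ {p : CSpace d × CSpace d | ‖p.1‖ = 1 ∧ ‖p.2‖ ≤ 1} from ⟨hζ, hz⟩) _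

theorem measurable_dilatedKernel {d : ℕ} (n : ℕ) :
    Measurable fun p : CSpace d × CSpace d => dilatedKernel n p.1 p.2 := by
  have hs : MeasurableSet {p : CSpace d × CSpace d | ‖p.1‖ = 1 ∧ ‖p.2‖ ≤ 1} :=
    (measurableSet_eq_fun (measurable_fst.norm) measurable_const).inter
      (measurableSet_le measurable_snd.norm measurable_const)
  have h : Measurable fun p : CSpace d × CSpace d => poissonSzego ((radius n : ℂ) • p.1) p.2 :=
    measurable_poissonSzego.comp (f := fun p : CSpace d × CSpace d => ((radius n : ℂ) • p.1, p.2))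
      ((measurable_fst.const_smul (radius n : ℂ)).prodMk measurable_snd)
  unfold dilatedKernel
  exact (h.indicator hs).comp (measurable_fst.prodMk measurable_snd)

theorem measurable_dilatedKernel_comp {d : ℕ} {X : Type*} [MeasurableSpace X] (n : ℕ)
    {u v : X → CSpace d} (hu : Measurable u) (hv : Measurable v) :
    Measurable fun x => dilatedKernel n (u x) (v x) := by
  have h := (measurable_dilatedKernel (d := d) n).comp (hu.prodMk hv)
  simpa only [Function.comp_def] using h

theorem norm_radius_smul {d : ℕ} (n : ℕ) (z : CSpace d) :
    ‖(radius n : ℂ) • z‖ = radius n * ‖z‖ := by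
  rw [norm_smul, Complex.norm_real, Real.norm_of_nonneg (radius_mem n).1.le]

theorem norm_radius_smul_lt {d : ℕ} (n : ℕ) {z : CSpace d} (hz : ‖z‖ ≤ 1) :
    ‖(radius n : ℂ) • z‖ < 1 :=
  mem_ball_zero_iff.1 (ofReal_smul_mem_ball hz (radius_mem n))

theorem dilatedKernel_nonneg {d : ℕ} (n : ℕ) (ζ z : CSpace d) : 0 ≤ dilatedKernel n ζ z := by
  refine indicator_nonneg (fun p hp => ?_) _
  exact poissonSzego_nonneg (norm_radius_smul_lt n hp.1.le).le _

/-- The cut-off in `dilatedKernel` makes the bound global, so for fixed `n` the kernel times a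
bounded measurable function is integrable for any finite measure. -/
theorem dilatedKernel_le {d : ℕ} (n : ℕ) (ζ z : CSpace d) :
    dilatedKernel n ζ z ≤ 1 / (1 - radius n) ^ (2 * d) := by
  refine indicator_apply_le' (fun hp => ?_) fun _ => ?_
  · have := poissonSzego_le (norm_radius_smul_lt n hp.1.le) hp.2
    rwa [norm_radius_smul, hp.1, mul_one] at this
  · have := sub_nonneg.2 (radius_mem n).2.le
    positivity

/-- The factor comparing the two ways of dilating the Poisson–Szegő kernel. -/
noncomputable def dilationRatio {d : ℕ} (n : ℕ) (z : CSpace d) : ℝ :=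
  ((1 - radius n ^ 2) / (1 - (radius n * ‖z‖) ^ 2)) ^ d

/-- Up to conjugation `⟨rζ, z⟩ = ⟨rz, ζ⟩`, so moving the dilation from `ζ` to `z` changes only the
numerator. -/
theorem dilatedKernel_eq_ratio_mul {d : ℕ} (n : ℕ) {ζ z : CSpace d} (hζ : ‖ζ‖ = 1) (hz : ‖z‖ ≤ 1) :
    dilatedKernel n ζ z = dilationRatio n z * poissonSzego ((radius n : ℂ) • z) ζ := by
  have h1 : 0 < 1 - (radius n * ‖z‖) ^ 2 := by
    have := norm_radius_smul_lt n hz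
    rw [norm_radius_smul] at this
    nlinarith [mul_nonneg (radius_mem n).1.le (norm_nonneg z)]
  have h2 : ‖1 - (inner ℂ ((radius n : ℂ) • ζ) z : ℂ)‖ =
      ‖1 - (inner ℂ ((radius n : ℂ) • z) ζ : ℂ)‖ := by
    rw [norm_one_sub_inner_comm]
    simp only [inner_smul_left, inner_smul_right, Complex.conj_ofReal]
  rw [dilatedKernel_of_mem n hζ hz, poissonSzego, poissonSzego, dilationRatio, h2, norm_radius_smul,
    norm_radius_smul, hζ, mul_one, div_pow]
  rw [div_mul_div_cancel₀ (pow_pos h1 d).ne']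

theorem dilationRatio_of_norm_eq_one {d : ℕ} (n : ℕ) {z : CSpace d} (hz : ‖z‖ = 1) :
    dilationRatio n z = 1 := by
  have h : 1 - radius n ^ 2 ≠ 0 := by nlinarith [(radius_mem n).1, (radius_mem n).2]
  rw [dilationRatio, hz, mul_one, div_self h, one_pow]

theorem dilationRatio_mem {d : ℕ} (n : ℕ) {z : CSpace d} (hz : ‖z‖ ≤ 1) :
    dilationRatio n z ∈ Icc (0 : ℝ) 1 := by
  have h := radius_mem n
  have h0 : 0 < 1 - radius n ^ 2 := by nlinarith [h.1, h.2]
  have h1 : (radius n * ‖z‖) ^ 2 ≤ radius n ^ 2 := by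
    have := mul_le_of_le_one_right h.1.le hz
    have := mul_nonneg h.1.le (norm_nonneg z)
    gcongr
  have h2 : 0 < 1 - (radius n * ‖z‖) ^ 2 := by linarith
  exact ⟨by unfold dilationRatio; positivity,
    pow_le_one₀ (by positivity) ((div_le_one h2).2 (by linarith))⟩

theorem tendsto_radius_nhds : Tendsto radius atTop (𝓝 1) :=
  tendsto_radius.mono_right nhdsWithin_le_nhds

/-- This is why mass of `μ` inside the open ball does not contribute to the limit. -/
theorem tendsto_dilationRatio {d : ℕ} (hd : 1 ≤ d) {z : CSpace d} (hz : ‖z‖ < 1) :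
    Tendsto (fun n => dilationRatio n z) atTop (𝓝 0) := by
  have h : Tendsto (fun n => ((1 - radius n ^ 2) / (1 - (radius n * ‖z‖) ^ 2)) ^ d) atTop
      (𝓝 (((1 - 1 ^ 2) / (1 - (1 * ‖z‖) ^ 2)) ^ d)) := by
    refine ((Tendsto.const_sub _ (tendsto_radius_nhds.pow 2)).div
      (Tendsto.const_sub _ ((tendsto_radius_nhds.mul_const _).pow 2)) ?_).pow d
    nlinarith [norm_nonneg z]
  rwa [one_pow, sub_self, zero_div, zero_pow (by omega)] at h

theorem integrable_mul_dilatedKernel {d : ℕ} {X : Type*} [MeasurableSpace X] {ν : Measure X}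
    [IsFiniteMeasure ν] (n : ℕ) {F : X → ℝ} {u v : X → CSpace d} (hF : Measurable F)
    (hu : Measurable u) (hv : Measurable v) {c : ℝ} (hc : ∀ x, ‖F x‖ ≤ c) :
    Integrable (fun x => F x * dilatedKernel n (u x) (v x)) ν := by
  refine Integrable.of_bound (hF.mul (measurable_dilatedKernel_comp n hu hv)).aestronglyMeasurable (c * (1 / (1 - radius n) ^ (2 * d))) (ae_of_all _ fun x => ?_)
  rw [norm_mul, Real.norm_of_nonneg (dilatedKernel_nonneg n _ _)]
  exact mul_le_mul (hc x) (dilatedKernel_le n _ _) (dilatedKernel_nonneg n _ _)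
    ((norm_nonneg _).trans (hc x))

theorem integral_dilatedKernel_left {d : ℕ} (hd : 1 ≤ d) (n : ℕ) {z : CSpace d} (hz : ‖z‖ ≤ 1) :
    ∫ ζ, dilatedKernel n ζ z ∂(sphereMeasure d) = dilationRatio n z := by
  rw [← mul_one (dilationRatio n z), ← integral_poissonSzego hd (norm_radius_smul_lt n hz),
    ← integral_const_mul]
  refine integral_congr_ae ?_
  filter_upwards [ae_sphereMeasure_norm_eq] with ζ hζ
  exact dilatedKernel_eq_ratio_mul n hζ hz

theorem integral_dilatedKernel_right {d : ℕ} (hd : 1 ≤ d) (n : ℕ) {ζ : CSpace d} (hζ : ‖ζ‖ = 1) :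
    ∫ z, dilatedKernel n ζ z ∂(sphereMeasure d) = 1 := by
  rw [← integral_poissonSzego hd (norm_radius_smul_lt n hζ.le)]
  refine integral_congr_ae ?_
  filter_upwards [ae_sphereMeasure_norm_eq] with z hz
  exact dilatedKernel_of_mem n hζ hz.le

/-! ### Dilates of `b` and the decay of their variance. -/

/-- The dilate `ζ ↦ b (r ζ)` with `r = radius n`, on the closed unit ball. -/
noncomputable def dilate {d : ℕ} (b : CSpace d → ℂ) (n : ℕ) (ζ : CSpace d) : ℂ :=
  (ball (0 : CSpace d) 1).indicator b ((radius n : ℂ) • ζ)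

theorem dilate_of_norm_le {d : ℕ} (b : CSpace d → ℂ) (n : ℕ) {ζ : CSpace d} (hζ : ‖ζ‖ ≤ 1) :
    dilate b n ζ = b ((radius n : ℂ) • ζ) :=
  indicator_of_mem (ofReal_smul_mem_ball hζ (radius_mem n)) _

theorem measurable_dilate {d : ℕ} {b : CSpace d → ℂ} (hb : ContinuousOn b (ball 0 1)) (n : ℕ) :
    Measurable (dilate b n) :=
  (measurable_indicator_ball hb).comp (measurable_const_smul _)

theorem norm_dilate_le_one {d : ℕ} {b : CSpace d → ℂ} (hmap : MapsTo b (ball 0 1) (ball 0 1))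
    (n : ℕ) (ζ : CSpace d) : ‖dilate b n ζ‖ ≤ 1 := by
  unfold dilate
  by_cases h : (radius n : ℂ) • ζ ∈ ball (0 : CSpace d) 1
  · rw [indicator_of_mem h]
    exact (mem_ball_zero_iff.1 (hmap h)).le
  · rw [indicator_of_notMem h]
    simp

theorem tendsto_dilate {d : ℕ} {b : CSpace d → ℂ} {ζ : CSpace d} (hζ : ‖ζ‖ ≤ 1) {l : ℂ}
    (h : HasRadialLimit b ζ l) : Tendsto (fun n => dilate b n ζ) atTop (𝓝 l) :=
  (h.comp tendsto_radius).congr fun n => (dilate_of_norm_le b n hζ).symm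

theorem tendsto_dilate_radius_smul {d : ℕ} {b : CSpace d → ℂ} {ζ : CSpace d} (hζ : ‖ζ‖ ≤ 1) {l : ℂ}
    (h : HasRadialLimit b ζ l) :
    Tendsto (fun n => dilate b n ((radius n : ℂ) • ζ)) atTop (𝓝 l) := by
  have h1 : Tendsto (fun n => radius n * radius n) atTop (𝓝[<] 1) := by
    refine tendsto_nhdsWithin_iff.2 ⟨by simpa using tendsto_radius_nhds.mul tendsto_radius_nhds,
      Eventually.of_forall fun n => ?_⟩
    exact mul_lt_one_of_nonneg_of_lt_one_left (radius_mem n).1.le (radius_mem n).2 (radius_mem n).2.le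
  refine (h.comp h1).congr fun n => ?_
  rw [dilate_of_norm_le b n (norm_radius_smul_lt n hζ).le, smul_smul, Function.comp_apply,
    Complex.ofReal_mul]

/-- The dilated Poisson–Szegő integral of the dilate of `b`. -/
theorem integral_dilate_mul_dilatedKernel {d : ℕ} (hd : 1 ≤ d) {b : CSpace d → ℂ}
    (hb : DifferentiableOn ℂ b (ball 0 1)) (n : ℕ) {z : CSpace d} (hz : ‖z‖ = 1) :
    ∫ ζ, dilate b n ζ * (dilatedKernel n ζ z : ℂ) ∂(sphereMeasure d) =
      dilate b n ((radius n : ℂ) • z) := by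
  rw [dilate_of_norm_le b n (norm_radius_smul_lt n hz.le).le,
    ← integral_mul_poissonSzego hd (diffContOnCl_dilation hb (radius_mem n))
      (norm_radius_smul_lt n hz.le)]
  refine integral_congr_ae ?_
  filter_upwards [ae_sphereMeasure_norm_eq] with ζ hζ
  rw [dilate_of_norm_le b n hζ.le, dilatedKernel_eq_ratio_mul n hζ hz.le,
    dilationRatio_of_norm_eq_one n hz, one_mul]

/-- The Poisson–Szegő variance of the dilate of `b` about the value `B z`. -/
noncomputable def dilatedVariance {d : ℕ} (b B : CSpace d → ℂ) (n : ℕ) (z : CSpace d) : ℝ :=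
  ∫ ζ, ‖B z - dilate b n ζ‖ ^ 2 * dilatedKernel n ζ z ∂(sphereMeasure d)

/-- Expand the square: the kernel has mass one for `z` on the sphere, and the cross term is a
Poisson–Szegő integral, evaluating to `b` at `r² z`. -/
theorem dilatedVariance_eq {d : ℕ} (hd : 1 ≤ d) {b B : CSpace d → ℂ}
    (hb : DifferentiableOn ℂ b (ball 0 1)) (hmap : MapsTo b (ball 0 1) (ball 0 1)) (n : ℕ)
    {z : CSpace d} (hz : ‖z‖ = 1) :
    dilatedVariance b B n z = ‖B z‖ ^ 2 +
      ∫ ζ, ‖dilate b n ζ‖ ^ 2 * dilatedKernel n ζ z ∂(sphereMeasure d) -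
      2 * (conj (B z) * dilate b n ((radius n : ℂ) • z)).re := by
  have := isProbabilityMeasure_sphereMeasure hd
  have hm := measurable_dilate hb.continuousOn n
  have h1 := norm_dilate_le_one hmap n
  have i1 : Integrable (fun ζ => ‖B z‖ ^ 2 * dilatedKernel n ζ z) (sphereMeasure d) :=
    integrable_mul_dilatedKernel n (F := fun _ => ‖B z‖ ^ 2) (u := fun ζ => ζ) (v := fun _ => z)
      (c := ‖‖B z‖ ^ 2‖) measurable_const measurable_id measurable_const fun _ => le_refl _
  have i2 : Integrable (fun ζ => ‖dilate b n ζ‖ ^ 2 * dilatedKernel n ζ z) (sphereMeasure d) := by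
    refine integrable_mul_dilatedKernel n (F := fun ζ => ‖dilate b n ζ‖ ^ 2) (u := fun ζ => ζ)
      (v := fun _ => z) (by fun_prop) measurable_id measurable_const (c := 1) fun ζ => ?_
    rw [norm_pow, norm_norm]
    exact pow_le_one₀ (norm_nonneg _) (h1 ζ)
  have i3 : Integrable (fun ζ => dilate b n ζ * (dilatedKernel n ζ z : ℂ)) (sphereMeasure d) := by
    have h2 : Measurable fun ζ : CSpace d => dilatedKernel n ζ z :=
      measurable_dilatedKernel_comp n (u := fun ζ => ζ) (v := fun _ => z) measurable_id measurable_const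
    refine Integrable.of_bound (Measurable.aestronglyMeasurable (by fun_prop))
      (1 / (1 - radius n) ^ (2 * d)) (ae_of_all _ fun ζ => ?_)
    rw [norm_mul, Complex.norm_real, Real.norm_of_nonneg (dilatedKernel_nonneg n _ _)]
    exact (mul_le_of_le_one_left (dilatedKernel_nonneg n _ _) (h1 ζ)).trans (dilatedKernel_le n _ _)
  have e : ∀ ζ, ‖B z - dilate b n ζ‖ ^ 2 * dilatedKernel n ζ z =
      (‖B z‖ ^ 2 * dilatedKernel n ζ z + ‖dilate b n ζ‖ ^ 2 * dilatedKernel n ζ z) -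
        2 * (conj (B z) * (dilate b n ζ * (dilatedKernel n ζ z : ℂ))).re := by
    intro ζ
    have h2 : (conj (B z) * (dilate b n ζ * (dilatedKernel n ζ z : ℂ))).re =
        (conj (B z) * dilate b n ζ).re * dilatedKernel n ζ z := by
      rw [← mul_assoc, Complex.re_mul_ofReal]
    have h3 := @norm_sub_sq ℂ ℂ _ _ _ (B z) (dilate b n ζ)
    rw [RCLike.inner_apply, mul_comm (dilate b n ζ), RCLike.re_eq_complex_re] at h3
    rw [h2, h3]
    ring
  have i4 : Integrable (fun ζ => 2 * (conj (B z) * (dilate b n ζ * (dilatedKernel n ζ z : ℂ))).re)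
      (sphereMeasure d) := ((i3.const_mul _).re).const_mul 2
  unfold dilatedVariance
  simp_rw [e]
  have i12 : Integrable (fun ζ => ‖B z‖ ^ 2 * dilatedKernel n ζ z +
      ‖dilate b n ζ‖ ^ 2 * dilatedKernel n ζ z) (sphereMeasure d) := i1.add i2
  rw [integral_sub i12 i4, integral_add i1 i2, integral_const_mul,
    integral_dilatedKernel_left hd n hz.le, dilationRatio_of_norm_eq_one n hz, mul_one,
    integral_const_mul]
  congr 2
  have h5 := integral_re (i3.const_mul (conj (B z)))
  simp only [RCLike.re_eq_complex_re] at h5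
  rw [h5, integral_const_mul, integral_dilate_mul_dilatedKernel hd hb n hz]

theorem integral_integral_norm_sq_dilate {d : ℕ} (hd : 1 ≤ d) {b : CSpace d → ℂ}
    (hb : ContinuousOn b (ball 0 1)) (hmap : MapsTo b (ball 0 1) (ball 0 1)) (n : ℕ) :
    ∫ z, ∫ ζ, ‖dilate b n ζ‖ ^ 2 * dilatedKernel n ζ z ∂(sphereMeasure d) ∂(sphereMeasure d) =
      ∫ ζ, ‖dilate b n ζ‖ ^ 2 ∂(sphereMeasure d) := by
  have := isProbabilityMeasure_sphereMeasure hd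
  have hm := measurable_dilate hb n
  rw [integral_integral_swap]
  · refine integral_congr_ae ?_
    filter_upwards [ae_sphereMeasure_norm_eq] with ζ hζ
    rw [integral_const_mul, integral_dilatedKernel_right hd n hζ, mul_one]
  · refine integrable_mul_dilatedKernel (X := CSpace d × CSpace d) n
      (u := Prod.snd) (v := Prod.fst)
      (F := fun p => ‖dilate b n p.2‖ ^ 2) (by fun_prop) measurable_snd measurable_fst (c := 1)
      fun p => ?_
    rw [norm_pow, norm_norm]
    exact pow_le_one₀ (norm_nonneg _) (norm_dilate_le_one hmap n _)

/-- Once integrated, the three terms of `dilatedVariance_eq` become integrals of `‖B z‖²`, `‖b (r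
z)‖²` and `-2 Re (conj (B z) b (r² z))`, so dominated convergence gives `1 + 1 - 2 = 0` times `∫
‖B‖²`. No maximal function is needed. -/
theorem tendsto_integral_dilatedVariance {d : ℕ} (hd : 1 ≤ d) {b B : CSpace d → ℂ}
    (hb : DifferentiableOn ℂ b (ball 0 1)) (hmap : MapsTo b (ball 0 1) (ball 0 1))
    (hBm : Measurable B) (hB1 : ∀ z, ‖B z‖ ≤ 1)
    (hB : ∀ᵐ z ∂(sphereMeasure d), IsBoundaryValue b B z) :
    Tendsto (fun n => ∫ z, dilatedVariance b B n z ∂(sphereMeasure d)) atTop (𝓝 0) := by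
  have := isProbabilityMeasure_sphereMeasure hd
  have hm := measurable_dilate hb.continuousOn
  have h1 := norm_dilate_le_one hmap
  have sq1 : ∀ u : ℂ, ‖u‖ ≤ 1 → ‖‖u‖ ^ 2‖ ≤ 1 := fun u hu => by
    rw [norm_pow, norm_norm]
    exact pow_le_one₀ (norm_nonneg _) hu
  have re1 : ∀ u v : ℂ, ‖u‖ ≤ 1 → ‖v‖ ≤ 1 → ‖(conj u * v).re‖ ≤ 1 := fun u v hu hv => by
    refine (Complex.abs_re_le_norm _).trans ?_
    rw [norm_mul, RCLike.norm_conj]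
    exact mul_le_one₀ hu (norm_nonneg _) hv
  have e : ∀ n, ∫ z, dilatedVariance b B n z ∂(sphereMeasure d) =
      ∫ z, (‖B z‖ ^ 2 + ‖dilate b n z‖ ^ 2 -
        2 * (conj (B z) * dilate b n ((radius n : ℂ) • z)).re) ∂(sphereMeasure d) := by
    intro n
    have hm' : Measurable fun z => dilate b n ((radius n : ℂ) • z) :=
      (hm n).comp (measurable_const_smul _)
    have i1 : Integrable (fun z => ‖B z‖ ^ 2) (sphereMeasure d) :=
      Integrable.of_bound (Measurable.aestronglyMeasurable (by fun_prop)) 1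
        (ae_of_all _ fun z => sq1 _ (hB1 z))
    have i2 : Integrable (fun z => ‖dilate b n z‖ ^ 2) (sphereMeasure d) :=
      Integrable.of_bound (Measurable.aestronglyMeasurable (by fun_prop)) 1
        (ae_of_all _ fun z => sq1 _ (h1 n z))
    have i3 : Integrable (fun z => 2 * (conj (B z) * dilate b n ((radius n : ℂ) • z)).re)
        (sphereMeasure d) :=
      (Integrable.of_bound (Measurable.aestronglyMeasurable (by fun_prop)) 1
        (ae_of_all _ fun z => re1 _ _ (hB1 z) (h1 n _))).const_mul 2
    have i4 : Integrable (fun z => ∫ ζ, ‖dilate b n ζ‖ ^ 2 * dilatedKernel n ζ z ∂(sphereMeasure d))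
        (sphereMeasure d) := by
      have := (integrable_mul_dilatedKernel (X := CSpace d × CSpace d)
        (ν := (sphereMeasure d).prod (sphereMeasure d)) n
        (u := Prod.snd) (v := Prod.fst)
      (F := fun p => ‖dilate b n p.2‖ ^ 2) (by have := hm n; fun_prop) measurable_snd measurable_fst
        (c := 1) fun p => sq1 _ (h1 n _))
      exact this.integral_prod_left
    have i12 : Integrable (fun z => ‖B z‖ ^ 2 + ‖dilate b n z‖ ^ 2) (sphereMeasure d) := i1.add i2
    have i14 : Integrable (fun z => ‖B z‖ ^ 2 +
        ∫ ζ, ‖dilate b n ζ‖ ^ 2 * dilatedKernel n ζ z ∂(sphereMeasure d)) (sphereMeasure d) :=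
      i1.add i4
    rw [integral_sub i12 i3, integral_add i1 i2,
      ← integral_integral_norm_sq_dilate hd hb.continuousOn hmap n, ← integral_add i1 i4,
      ← integral_sub i14 i3]
    refine integral_congr_ae ?_
    filter_upwards [ae_sphereMeasure_norm_eq] with z hz
    exact dilatedVariance_eq hd hb hmap n hz
  simp_rw [e]
  rw [← integral_zero (CSpace d) ℝ (μ := sphereMeasure d)]
  refine tendsto_integral_of_dominated_convergence (fun _ => 4) (fun n => ?_)
    (integrable_const _) (fun n => ae_of_all _ fun z => ?_) ?_
  · have := hm n
    have hm' : Measurable fun z => dilate b n ((radius n : ℂ) • z) :=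
      (hm n).comp (measurable_const_smul _)
    exact Measurable.aestronglyMeasurable (by fun_prop)
  · have a1 := sq1 _ (hB1 z)
    have a2 := sq1 _ (h1 n z)
    have a3 := re1 _ _ (hB1 z) (h1 n ((radius n : ℂ) • z))
    rw [Real.norm_eq_abs, abs_le] at *
    constructor <;> linarith [a1.1, a1.2, a2.1, a2.2, a3.1, a3.2]
  · filter_upwards [hB, ae_sphereMeasure_norm_eq] with z hz hz1
    rcases hz with ⟨h, -⟩ | ⟨-, h⟩
    · exact absurd hz1 h.ne
    · have t1 := (tendsto_dilate hz1.le h).norm.pow 2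
      have t2 := tendsto_dilate_radius_smul hz1.le h
      have t3 := (Complex.continuous_re.tendsto _).comp (t2.const_mul (conj (B z)))
      have t4 := (t1.const_add (‖B z‖ ^ 2)).sub (t3.const_mul 2)
      refine t4.trans (le_of_eq ?_)
      congr 1
      rw [Complex.conj_mul', ← Complex.ofReal_pow, Complex.ofReal_re]
      ring

/-! ### Averaging the reverse Carleson inequality over a sphere. -/

theorem norm_one_sub_mul_conj_sq_le_four {u v : ℂ} (hu : ‖u‖ ≤ 1) (hv : ‖v‖ ≤ 1) :
    ‖1 - u * conj v‖ ^ 2 ≤ 4 := by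
  have h : ‖1 - u * conj v‖ ≤ 2 := by
    refine (norm_sub_le _ _).trans ?_
    rw [norm_one, norm_mul, RCLike.norm_conj]
    nlinarith [norm_nonneg u, norm_nonneg v]
  nlinarith [norm_nonneg (1 - u * conj v)]

/-- From `1 - u conj v = (1 - |u|²) + u conj (u - v)`. The first factor `2` is the one in the final
constant. -/
theorem norm_one_sub_mul_conj_sq_le {u v : ℂ} (hu : ‖u‖ ≤ 1) :
    ‖1 - u * conj v‖ ^ 2 ≤ 2 * (1 - ‖u‖ ^ 2) ^ 2 + 2 * ‖u - v‖ ^ 2 := by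
  have e : 1 - u * conj v = ((1 - ‖u‖ ^ 2 : ℝ) : ℂ) + u * conj (u - v) := by
    rw [map_sub, mul_sub, Complex.mul_conj']
    push_cast
    ring
  have h0 : 0 ≤ 1 - ‖u‖ ^ 2 := by nlinarith [norm_nonneg u]
  have h : ‖1 - u * conj v‖ ≤ (1 - ‖u‖ ^ 2) + ‖u - v‖ := by
    rw [e]
    refine (norm_add_le _ _).trans ?_
    rw [Complex.norm_real, Real.norm_of_nonneg h0, norm_mul, RCLike.norm_conj]
    have := mul_le_of_le_one_left (norm_nonneg (u - v)) hu
    linarith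
  nlinarith [norm_nonneg (1 - u * conj v), norm_nonneg (u - v),
    sq_nonneg ((1 - ‖u‖ ^ 2) - ‖u - v‖)]

/-- The Poisson–Szegő integral of `φ ‖1 - B z conj b‖²` on the sphere of radius `radius n`. -/
noncomputable def dilatedAverage {d : ℕ} (b B : CSpace d → ℂ) (φ : CSpace d → ℝ) (n : ℕ)
    (z : CSpace d) : ℝ :=
  ∫ ζ, (φ ζ * ‖1 - B z * conj (dilate b n ζ)‖ ^ 2) * dilatedKernel n ζ z ∂(sphereMeasure d)

theorem norm_mul_norm_one_sub_le_four {t : ℝ} (ht : t ∈ Icc (0 : ℝ) 1) {u v : ℂ}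
    (hu : ‖u‖ ≤ 1) (hv : ‖v‖ ≤ 1) : ‖t * ‖1 - u * conj v‖ ^ 2‖ ≤ 4 := by
  rw [Real.norm_of_nonneg (mul_nonneg ht.1 (by positivity))]
  have := norm_one_sub_mul_conj_sq_le_four hu hv
  exact (mul_le_of_le_one_left (by positivity) ht.2).trans this

theorem integrable_dilatedAverage_prod {d : ℕ} {b B : CSpace d → ℂ}
    {φ : CSpace d → ℝ} (hb : ContinuousOn b (ball 0 1)) (hmap : MapsTo b (ball 0 1) (ball 0 1))
    (hBm : Measurable B) (hB1 : ∀ z, ‖B z‖ ≤ 1) (hφm : Measurable φ)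
    (hφ : ∀ z, φ z ∈ Icc (0 : ℝ) 1) (n : ℕ) (ρ : Measure (CSpace d × CSpace d))
    [IsFiniteMeasure ρ] :
    Integrable (fun p => (φ p.1 * ‖1 - B p.2 * conj (dilate b n p.1)‖ ^ 2) *
      dilatedKernel n p.1 p.2) ρ := by
  have hm := measurable_dilate hb n
  refine integrable_mul_dilatedKernel (X := CSpace d × CSpace d) n (u := Prod.fst) (v := Prod.snd)
    (F := fun p => φ p.1 * ‖1 - B p.2 * conj (dilate b n p.1)‖ ^ 2) (by fun_prop) measurable_fst
    measurable_snd (c := 4) fun p => ?_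
  exact norm_mul_norm_one_sub_le_four (hφ _) (hB1 _) (norm_dilate_le_one hmap n _)

theorem integrable_dilatedAverage_left {d : ℕ} (hd : 1 ≤ d) {b B : CSpace d → ℂ}
    {φ : CSpace d → ℝ} (hb : ContinuousOn b (ball 0 1)) (hmap : MapsTo b (ball 0 1) (ball 0 1))
    (hB1 : ∀ z, ‖B z‖ ≤ 1) (hφm : Measurable φ) (hφ : ∀ z, φ z ∈ Icc (0 : ℝ) 1) (n : ℕ)
    (z : CSpace d) :
    Integrable (fun ζ => (φ ζ * ‖1 - B z * conj (dilate b n ζ)‖ ^ 2) *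
      dilatedKernel n ζ z) (sphereMeasure d) := by
  have := isProbabilityMeasure_sphereMeasure hd
  have hm := measurable_dilate hb n
  refine integrable_mul_dilatedKernel n (u := fun ζ => ζ) (v := fun _ => z)
    (F := fun ζ => φ ζ * ‖1 - B z * conj (dilate b n ζ)‖ ^ 2) (by fun_prop) measurable_id
    measurable_const (c := 4) fun p => ?_
  exact norm_mul_norm_one_sub_le_four (hφ _) (hB1 _) (norm_dilate_le_one hmap n _)

theorem measurable_dilatedAverage {d : ℕ} (hd : 1 ≤ d) {b B : CSpace d → ℂ} {φ : CSpace d → ℝ}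
    (hb : ContinuousOn b (ball 0 1)) (hBm : Measurable B) (hφm : Measurable φ) (n : ℕ) :
    Measurable (dilatedAverage b B φ n) := by
  have := isProbabilityMeasure_sphereMeasure hd
  have hm := measurable_dilate hb n
  have h1 : Measurable fun p : CSpace d × CSpace d => dilatedKernel n p.2 p.1 :=
    measurable_dilatedKernel_comp n measurable_snd measurable_fst
  have h2 : Measurable fun p : CSpace d × CSpace d =>
      (φ p.2 * ‖1 - B p.1 * conj (dilate b n p.2)‖ ^ 2) * dilatedKernel n p.2 p.1 := by
    fun_prop
  exact (h2.stronglyMeasurable.integral_prod_right' (ν := sphereMeasure d)).measurable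

theorem dilatedAverage_nonneg {d : ℕ} {b B : CSpace d → ℂ} {φ : CSpace d → ℝ}
    (hφ : ∀ z, φ z ∈ Icc (0 : ℝ) 1) (n : ℕ) (z : CSpace d) : 0 ≤ dilatedAverage b B φ n z :=
  integral_nonneg fun ζ => mul_nonneg (mul_nonneg (hφ ζ).1 (by positivity))
    (dilatedKernel_nonneg n ζ z)

theorem integrable_dilatedKernel_mul_left {d : ℕ} (hd : 1 ≤ d) {F : CSpace d → ℝ} (hF : Measurable F)
    {c : ℝ} (hc : ∀ ζ, ‖F ζ‖ ≤ c) (n : ℕ) (z : CSpace d) :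
    Integrable (fun ζ => F ζ * dilatedKernel n ζ z) (sphereMeasure d) := by
  have := isProbabilityMeasure_sphereMeasure hd
  exact integrable_mul_dilatedKernel n (u := fun ζ => ζ) (v := fun _ => z) hF measurable_id
    measurable_const hc

theorem norm_le_one_of_mem_Icc {t : ℝ} (ht : t ∈ Icc (0 : ℝ) 1) : ‖t‖ ≤ 1 := by
  rw [Real.norm_of_nonneg ht.1]
  exact ht.2

/-- The crude bound, for points where the variance is not controlled: the open ball and the set
carrying the singular part. -/
theorem dilatedAverage_le_four_mul {d : ℕ} (hd : 1 ≤ d) {b B : CSpace d → ℂ} {φ : CSpace d → ℝ}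
    (hb : ContinuousOn b (ball 0 1)) (hmap : MapsTo b (ball 0 1) (ball 0 1))
    (hB1 : ∀ z, ‖B z‖ ≤ 1) (hφm : Measurable φ) (hφ : ∀ z, φ z ∈ Icc (0 : ℝ) 1) (n : ℕ)
    (z : CSpace d) :
    dilatedAverage b B φ n z ≤ 4 * ∫ ζ, φ ζ * dilatedKernel n ζ z ∂(sphereMeasure d) := by
  rw [← integral_const_mul]
  refine integral_mono (integrable_dilatedAverage_left hd hb hmap hB1 hφm hφ n z)
    ((integrable_dilatedKernel_mul_left hd hφm (fun ζ => norm_le_one_of_mem_Icc (hφ ζ)) n z).const_mul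
      4) fun ζ => ?_
  have h1 := norm_one_sub_mul_conj_sq_le_four (hB1 z) (norm_dilate_le_one hmap n ζ)
  have h2 := mul_nonneg (hφ ζ).1 (dilatedKernel_nonneg n ζ z)
  have := mul_le_mul_of_nonneg_left h1 h2
  dsimp only
  linarith

theorem integral_mul_dilatedKernel_le_ratio {d : ℕ} (hd : 1 ≤ d) {φ : CSpace d → ℝ}
    (hφm : Measurable φ) (hφ : ∀ z, φ z ∈ Icc (0 : ℝ) 1) (n : ℕ) {z : CSpace d} (hz : ‖z‖ ≤ 1) :
    ∫ ζ, φ ζ * dilatedKernel n ζ z ∂(sphereMeasure d) ≤ dilationRatio n z := by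
  rw [← integral_dilatedKernel_left hd n hz]
  have i1 := integrable_dilatedKernel_mul_left hd (F := fun _ => 1) measurable_const
    (fun _ => le_refl _) n z
  simp only [one_mul] at i1
  refine integral_mono (integrable_dilatedKernel_mul_left hd hφm
    (fun ζ => norm_le_one_of_mem_Icc (hφ ζ)) n z) i1 fun ζ => ?_
  exact mul_le_of_le_one_left (dilatedKernel_nonneg n ζ z) (hφ ζ).2

theorem dilatedAverage_le_add_dilatedVariance {d : ℕ} (hd : 1 ≤ d) {b B : CSpace d → ℂ}
    {φ : CSpace d → ℝ} (hb : ContinuousOn b (ball 0 1)) (hmap : MapsTo b (ball 0 1) (ball 0 1))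
    (hB1 : ∀ z, ‖B z‖ ≤ 1) (hφm : Measurable φ) (hφ : ∀ z, φ z ∈ Icc (0 : ℝ) 1) (n : ℕ)
    (z : CSpace d) :
    dilatedAverage b B φ n z ≤
      2 * (1 - ‖B z‖ ^ 2) ^ 2 * ∫ ζ, φ ζ * dilatedKernel n ζ z ∂(sphereMeasure d) +
        2 * dilatedVariance b B n z := by
  have hm := measurable_dilate hb n
  have i1 := (integrable_dilatedKernel_mul_left hd hφm (fun ζ => norm_le_one_of_mem_Icc (hφ ζ))
    n z).const_mul (2 * (1 - ‖B z‖ ^ 2) ^ 2)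
  have i2 := (integrable_dilatedKernel_mul_left hd (F := fun ζ => ‖B z - dilate b n ζ‖ ^ 2)
    (c := 4) (by fun_prop) (fun ζ => by
      rw [norm_pow, norm_norm]
      have h1 : ‖B z - dilate b n ζ‖ ≤ 2 := by
        refine (norm_sub_le _ _).trans ?_
        linarith [hB1 z, norm_dilate_le_one hmap n ζ]
      nlinarith [norm_nonneg (B z - dilate b n ζ)]) n z).const_mul 2
  unfold dilatedVariance
  rw [← integral_const_mul, ← integral_const_mul, ← integral_add i1 i2]
  refine integral_mono (integrable_dilatedAverage_left hd hb hmap hB1 hφm hφ n z) (i1.add i2)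
    fun ζ => ?_
  have h1 := norm_one_sub_mul_conj_sq_le (v := dilate b n ζ) (hB1 z)
  have h2 := mul_le_mul_of_nonneg_left h1 (hφ ζ).1
  have h3 := mul_le_of_le_one_left (by positivity : 0 ≤ 2 * ‖B z - dilate b n ζ‖ ^ 2) (hφ ζ).2
  have h4 : φ ζ * ‖1 - B z * conj (dilate b n ζ)‖ ^ 2 ≤
      2 * (1 - ‖B z‖ ^ 2) ^ 2 * φ ζ + 2 * ‖B z - dilate b n ζ‖ ^ 2 := by linarith
  have h5 := mul_le_mul_of_nonneg_right h4 (dilatedKernel_nonneg n ζ z)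
  simp only
  linarith

/-- The reverse Carleson inequality, tested on kernel functions and averaged against `φ` over the
sphere of radius `radius n`. -/
theorem IsReverseCarlesonWith.integral_le {d : ℕ} (hd : 1 ≤ d) {A : ℝ≥0} {b : CSpace d → ℂ}
    {μ : Measure (CSpace d)} [IsFiniteMeasure μ] (hμ : ∀ᵐ z ∂μ, ‖z‖ ≤ 1)
    (hb : IsAdmissible μ b) (hmap : MapsTo b (ball 0 1) (ball 0 1))
    (hA : IsReverseCarlesonWith A b μ) {B : CSpace d → ℂ} (hBm : Measurable B)
    (hB1 : ∀ z, ‖B z‖ ≤ 1) (hB : ∀ᵐ z ∂μ, IsBoundaryValue b B z) {φ : CSpace d → ℝ}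
    (hφm : Measurable φ) (hφ : ∀ z, φ z ∈ Icc (0 : ℝ) 1) (n : ℕ) :
    ∫ ζ, φ ζ * (1 - ‖dilate b n ζ‖ ^ 2) ∂(sphereMeasure d) ≤
      (A : ℝ) ^ 2 * ∫ z, dilatedAverage b B φ n z ∂μ := by
  have := isProbabilityMeasure_sphereMeasure hd
  have hm := measurable_dilate hb.holomorphic.continuousOn n
  have hi := integrable_dilatedAverage_prod hb.holomorphic.continuousOn hmap hBm hB1 hφm hφ n
    ((sphereMeasure d).prod μ)
  unfold dilatedAverage
  rw [← integral_integral_swap hi, ← integral_const_mul]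
  refine integral_mono_ae ?_ (hi.integral_prod_left.const_mul _) ?_
  · refine Integrable.of_bound (Measurable.aestronglyMeasurable (by fun_prop)) 1
      (ae_of_all _ fun ζ => norm_le_one_of_mem_Icc ?_)
    have h1 : ‖dilate b n ζ‖ ^ 2 ≤ 1 := pow_le_one₀ (norm_nonneg _) (norm_dilate_le_one hmap n ζ)
    exact ⟨mul_nonneg (hφ ζ).1 (by linarith),
      mul_le_one₀ (hφ ζ).2 (by linarith) (by nlinarith [norm_nonneg (dilate b n ζ)])⟩
  · filter_upwards [ae_sphereMeasure_norm_eq] with ζ hζ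
    have h1 := hA.one_sub_norm_sq_le hd hμ hb hmap hBm hB1 hB (norm_radius_smul_lt n hζ.le)
    have h2 := mul_le_mul_of_nonneg_left h1 (hφ ζ).1
    rw [dilate_of_norm_le b n hζ.le]
    refine h2.trans (le_of_eq ?_)
    rw [mul_left_comm, ← integral_const_mul]
    congr 1
    refine integral_congr_ae ?_
    filter_upwards [hμ] with z hz
    rw [dilatedKernel_of_mem n hζ hz, mul_assoc]

/-- The real part on the right is `(1 - r) + r ‖z - ζ‖² / 2`. -/
theorem half_mul_norm_sub_sq_le {d : ℕ} {r : ℝ} (hr : r ∈ Ioo (0 : ℝ) 1) {z ζ : CSpace d}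
    (hz : ‖z‖ = 1) (hζ : ‖ζ‖ = 1) :
    r * ‖z - ζ‖ ^ 2 / 2 ≤ ‖1 - (inner ℂ ((r : ℂ) • z) ζ : ℂ)‖ := by
  have h1 := @norm_sub_sq ℂ (CSpace d) _ _ _ z ζ
  rw [hz, hζ, RCLike.re_eq_complex_re] at h1
  have h2 := Complex.re_le_norm (1 - (inner ℂ ((r : ℂ) • z) ζ : ℂ))
  rw [inner_smul_left, Complex.conj_ofReal, Complex.sub_re, Complex.one_re,
    Complex.re_ofReal_mul] at h2
  rw [inner_smul_left, Complex.conj_ofReal]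
  nlinarith [hr.1, hr.2]

/-- An approximate identity: mass one, and at distance `δ` from `z` the kernel is uniformly of order
`(1 - r²) ^ d`. -/
theorem tendsto_integral_mul_dilatedKernel {d : ℕ} (hd : 1 ≤ d) {φ : CSpace d → ℝ}
    (hφc : Continuous φ) (hφ : ∀ z, φ z ∈ Icc (0 : ℝ) 1) {z : CSpace d} (hz : ‖z‖ = 1) :
    Tendsto (fun n => ∫ ζ, φ ζ * dilatedKernel n ζ z ∂(sphereMeasure d)) atTop (𝓝 (φ z)) := by
  have := isProbabilityMeasure_sphereMeasure hd
  have key : Tendsto (fun n => ∫ ζ, dilatedKernel n ζ z • φ ζ ∂(sphereMeasure d)) atTop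
      (𝓝 (φ z)) := by
    refine tendsto_integral_peak_smul_of_integrable_of_tendsto (t := univ) (x₀ := z)
      MeasurableSet.univ univ_mem (measure_ne_top _ _)
      (Eventually.of_forall fun n ζ => dilatedKernel_nonneg n ζ z) ?_ ?_
      (Eventually.of_forall fun n => ?_) ?_ hφc.continuousAt
    · intro u hu hzu
      obtain ⟨δ, hδ, hsub⟩ := Metric.isOpen_iff.1 hu z hzu
      have h1 : Tendsto (fun n => (1 - radius n ^ 2) ^ d / (radius n * δ ^ 2 / 2) ^ (2 * d)) atTop
          (𝓝 ((1 - 1 ^ 2) ^ d / (1 * δ ^ 2 / 2) ^ (2 * d))) := by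
        refine Tendsto.div ((Tendsto.const_sub _ (tendsto_radius_nhds.pow 2)).pow d)
          (((tendsto_radius_nhds.mul_const _).div_const _).pow _) (by positivity)
      rw [one_pow, sub_self, zero_pow (by omega), zero_div] at h1
      rw [Metric.tendstoUniformlyOn_iff]
      intro ε hε
      filter_upwards [h1.eventually_lt_const hε] with n hn ζ hζ
      rw [Pi.zero_apply, dist_zero_left, Real.norm_of_nonneg (dilatedKernel_nonneg n ζ z)]
      refine lt_of_le_of_lt ?_ hn
      have hr := radius_mem n
      have h0 : 0 ≤ 1 - radius n ^ 2 := by nlinarith [hr.1, hr.2]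
      have hr0 := hr.1
      by_cases h : ‖ζ‖ = 1
      · rw [dilatedKernel_eq_ratio_mul n h hz.le, dilationRatio_of_norm_eq_one n hz, one_mul,
          poissonSzego, norm_radius_smul, hz, mul_one]
        have h2 := half_mul_norm_sub_sq_le hr hz h
        have h3 : δ ≤ ‖z - ζ‖ := by
          by_contra hlt
          refine hζ (hsub ?_)
          rw [mem_ball, dist_comm, dist_eq_norm]
          exact not_le.1 hlt
        have h4 : radius n * δ ^ 2 / 2 ≤ ‖1 - (inner ℂ ((radius n : ℂ) • z) ζ : ℂ)‖ := by
          refine le_trans ?_ h2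
          gcongr
        gcongr
      · rw [dilatedKernel, indicator_of_notMem fun h' => h h'.1]
        positivity
    · refine tendsto_const_nhds.congr fun n => ?_
      rw [setIntegral_univ, integral_dilatedKernel_left hd n hz.le, dilationRatio_of_norm_eq_one n hz]
    · exact (measurable_dilatedKernel_comp n (u := fun ζ => ζ) (v := fun _ => z) measurable_id
        measurable_const).aestronglyMeasurable
    · exact Integrable.of_bound hφc.aestronglyMeasurable 1
        (ae_of_all _ fun ζ => norm_le_one_of_mem_Icc (hφ ζ))
  refine key.congr fun n => ?_
  simp only [smul_eq_mul, mul_comm]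

/-! ### The limit of the averaged inequality. -/

theorem exists_subseq_dilatedVariance_tendsto {d : ℕ} (hd : 1 ≤ d) {b B : CSpace d → ℂ}
    (hb : DifferentiableOn ℂ b (ball 0 1)) (hmap : MapsTo b (ball 0 1) (ball 0 1))
    (hBm : Measurable B) (hB1 : ∀ z, ‖B z‖ ≤ 1)
    (hB : ∀ᵐ z ∂(sphereMeasure d), IsBoundaryValue b B z) :
    ∃ ns : ℕ → ℕ, StrictMono ns ∧ ∀ᵐ z ∂(sphereMeasure d),
      Tendsto (fun i => dilatedVariance b B (ns i) z) atTop (𝓝 0) := by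
  have := isProbabilityMeasure_sphereMeasure hd
  have hint : ∀ n, Integrable (dilatedVariance b B n) (sphereMeasure d) := by
    intro n
    have hm := measurable_dilate hb.continuousOn n
    have := integrable_mul_dilatedKernel (X := CSpace d × CSpace d) n (u := Prod.snd)
      (v := Prod.fst) (F := fun p => ‖B p.1 - dilate b n p.2‖ ^ 2) (by fun_prop) measurable_snd
      measurable_fst (ν := (sphereMeasure d).prod (sphereMeasure d)) (c := 4) fun p => by
        rw [norm_pow, norm_norm]
        have h1 : ‖B p.1 - dilate b n p.2‖ ≤ 2 := by
          refine (norm_sub_le _ _).trans ?_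
          linarith [hB1 p.1, norm_dilate_le_one hmap n p.2]
        nlinarith [norm_nonneg (B p.1 - dilate b n p.2)]
    exact this.integral_prod_left
  have hnn : ∀ n z, 0 ≤ dilatedVariance b B n z := fun n z =>
    integral_nonneg fun ζ => mul_nonneg (by positivity) (dilatedKernel_nonneg n ζ z)
  refine TendstoInMeasure.exists_seq_tendsto_ae (g := fun _ => 0)
    (tendstoInMeasure_of_tendsto_eLpNorm (p := 1) one_ne_zero
      (fun n => (hint n).aestronglyMeasurable) aestronglyMeasurable_const ?_)
  have h1 := ENNReal.tendsto_ofReal (tendsto_integral_dilatedVariance hd hb hmap hBm hB1 hB)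
  rw [ENNReal.ofReal_zero] at h1
  refine h1.congr fun n => ?_
  rw [ofReal_integral_eq_lintegral_ofReal (hint n) (ae_of_all _ (hnn n)),
    eLpNorm_one_eq_lintegral_enorm]
  refine lintegral_congr fun z => ?_
  simp only [Pi.sub_apply, sub_zero]
  rw [Real.enorm_of_nonneg (hnn n z)]

/-- The boundary weight in the limit of the averaged reverse Carleson inequality: `4` on the set `N`
and `2 (1 - ‖B‖²)²` elsewhere. -/
noncomputable def boundaryWeight {d : ℕ} (B : CSpace d → ℂ) (N : Set (CSpace d)) (z : CSpace d) :
    ℝ :=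
  open scoped Classical in if z ∈ N then 4 else 2 * (1 - ‖B z‖ ^ 2) ^ 2

theorem measurable_boundaryWeight {d : ℕ} {B : CSpace d → ℂ} (hB : Measurable B)
    {N : Set (CSpace d)} (hN : MeasurableSet N) : Measurable (boundaryWeight B N) := by
  classical
  unfold boundaryWeight
  exact Measurable.ite hN measurable_const (by fun_prop)

theorem one_sub_norm_sq_mem_Icc {u : ℂ} (hu : ‖u‖ ≤ 1) : 1 - ‖u‖ ^ 2 ∈ Icc (0 : ℝ) 1 := by
  have := pow_le_one₀ (n := 2) (norm_nonneg _) hu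
  exact ⟨by linarith, by nlinarith [norm_nonneg u]⟩

theorem boundaryWeight_mem {d : ℕ} {B : CSpace d → ℂ} (hB1 : ∀ z, ‖B z‖ ≤ 1) (N : Set (CSpace d))
    (z : CSpace d) : boundaryWeight B N z ∈ Icc (0 : ℝ) 4 := by
  unfold boundaryWeight
  split_ifs
  · norm_num
  · have := one_sub_norm_sq_mem_Icc (hB1 z)
    have h2 := pow_le_one₀ (n := 2) this.1 this.2
    exact ⟨by positivity, by linarith⟩

/-- Off `N`, absolute continuity transfers the σ-almost everywhere decay of the variance to `μ` on
the sphere; on `N` the weight `4` asks for nothing. -/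
theorem IsReverseCarlesonWith.integral_le_boundaryWeight {d : ℕ} (hd : 1 ≤ d) {A : ℝ≥0}
    {b : CSpace d → ℂ} {μ : Measure (CSpace d)} [IsFiniteMeasure μ] (hμ : ∀ᵐ z ∂μ, ‖z‖ ≤ 1)
    (hb : IsAdmissible μ b) (hmap : MapsTo b (ball 0 1) (ball 0 1))
    (hA : IsReverseCarlesonWith A b μ) {B : CSpace d → ℂ} (hBm : Measurable B)
    (hB1 : ∀ z, ‖B z‖ ≤ 1) (hB : ∀ᵐ z ∂μ, IsBoundaryValue b B z)
    (hBσ : ∀ᵐ z ∂(sphereMeasure d), IsBoundaryValue b B z) {N : Set (CSpace d)}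
    (hN : MeasurableSet N) (hac : ((μ.restrict (sphere 0 1)).restrict Nᶜ) ≪ sphereMeasure d)
    {φ : CSpace d → ℝ} (hφc : Continuous φ) (hφ : ∀ z, φ z ∈ Icc (0 : ℝ) 1) :
    ∫ ζ, φ ζ * (1 - ‖B ζ‖ ^ 2) ∂(sphereMeasure d) ≤
      (A : ℝ) ^ 2 * ∫ z in sphere 0 1, φ z * boundaryWeight B N z ∂μ := by
  have := isProbabilityMeasure_sphereMeasure hd
  have hm := measurable_dilate hb.holomorphic.continuousOn
  obtain ⟨ns, hns, hJ⟩ :=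
    exists_subseq_dilatedVariance_tendsto hd hb.holomorphic hmap hBm hB1 hBσ
  have hφm := hφc.measurable
  have hwm := measurable_boundaryWeight hBm hN
  have hw := boundaryWeight_mem hB1 N
  set W : CSpace d → ℝ := (sphere 0 1).indicator fun z => φ z * boundaryWeight B N z with hW
  have hWm : Measurable W := (hφm.mul hwm).indicator isClosed_sphere.measurableSet
  have hW4 : ∀ z, W z ∈ Icc (0 : ℝ) 4 := by
    intro z
    by_cases hz : z ∈ sphere (0 : CSpace d) 1
    · rw [hW, indicator_of_mem hz]
      exact ⟨mul_nonneg (hφ z).1 (hw z).1,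
        (mul_le_of_le_one_left (hw z).1 (hφ z).2).trans (hw z).2⟩
    · rw [hW, indicator_of_notMem hz]
      norm_num
  rw [← integral_indicator isClosed_sphere.measurableSet, ← hW]
  have hJμ : ∀ᵐ z ∂μ, ‖z‖ = 1 → z ∉ N →
      Tendsto (fun i => dilatedVariance b B (ns i) z) atTop (𝓝 0) := by
    have h1 : ∀ᵐ z ∂((μ.restrict (sphere 0 1)).restrict Nᶜ),
        Tendsto (fun i => dilatedVariance b B (ns i) z) atTop (𝓝 0) := hac.ae_le hJ
    rw [ae_restrict_iff' hN.compl, ae_restrict_iff' isClosed_sphere.measurableSet] at h1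
    filter_upwards [h1] with z hz h2 h3
    exact hz (by simpa using h2) h3
  have hI4 : ∀ n, ∀ z, ‖z‖ ≤ 1 → dilatedAverage b B φ n z ≤ 4 := by
    intro n z hz
    have h1 := dilatedAverage_le_four_mul hd hb.holomorphic.continuousOn hmap hB1 hφm hφ n z
    have h2 := integral_mul_dilatedKernel_le_ratio hd hφm hφ n hz
    linarith [(dilationRatio_mem (d := d) n hz).2]
  -- Only upper bounds tending to `W` are known for the averages. Their maximum with `W` does
  -- converge to `W`, so dominated convergence applies to it.
  have hlim : Tendsto (fun i => ∫ z, max (dilatedAverage b B φ (ns i) z) (W z) ∂μ) atTop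
      (𝓝 (∫ z, W z ∂μ)) := by
    refine tendsto_integral_of_dominated_convergence (fun _ => 4) (fun i => ?_)
      (integrable_const _) (fun i => ?_) ?_
    · exact ((measurable_dilatedAverage hd hb.holomorphic.continuousOn hBm hφm _).max
        hWm).aestronglyMeasurable
    · filter_upwards [hμ] with z hz
      rw [Real.norm_of_nonneg (le_max_of_le_right (hW4 z).1)]
      exact max_le (hI4 _ z hz) (hW4 z).2
    · filter_upwards [hμ, hJμ] with z hz hJz
      have hV : ∀ V : ℕ → ℝ, (∀ n, dilatedAverage b B φ n z ≤ V n) →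
          Tendsto (fun i => V (ns i)) atTop (𝓝 (W z)) →
          Tendsto (fun i => max (dilatedAverage b B φ (ns i) z) (W z)) atTop (𝓝 (W z)) := by
        intro V hV1 hV2
        have h1 : Tendsto (fun i => max (V (ns i)) (W z)) atTop (𝓝 (W z)) := by
          simpa using hV2.max (tendsto_const_nhds (x := W z))
        exact tendsto_of_tendsto_of_tendsto_of_le_of_le tendsto_const_nhds h1
          (fun i => le_max_right _ _) fun i => max_le_max_right _ (hV1 _)
      rcases hz.lt_or_eq with h | h
      · have hz' : z ∉ sphere (0 : CSpace d) 1 := by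
          rw [mem_sphere_zero_iff_norm]
          exact h.ne
        refine hV (fun n => 4 * dilationRatio n z) (fun n => ?_) ?_
        · have h1 := dilatedAverage_le_four_mul hd hb.holomorphic.continuousOn hmap hB1 hφm hφ n z
          have h2 := integral_mul_dilatedKernel_le_ratio hd hφm hφ n hz
          linarith
        · rw [hW, indicator_of_notMem hz']
          simpa using ((tendsto_dilationRatio hd h).comp hns.tendsto_atTop).const_mul 4
      · have hz' : z ∈ sphere (0 : CSpace d) 1 := mem_sphere_zero_iff_norm.2 h
        have hP := (tendsto_integral_mul_dilatedKernel hd hφc hφ h).comp hns.tendsto_atTop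
        by_cases hzN : z ∈ N
        · refine hV _
            (dilatedAverage_le_four_mul hd hb.holomorphic.continuousOn hmap hB1 hφm hφ · z) ?_
          rw [hW, indicator_of_mem hz', boundaryWeight, if_pos hzN, mul_comm (φ z)]
          exact hP.const_mul 4
        · refine hV _ (dilatedAverage_le_add_dilatedVariance hd hb.holomorphic.continuousOn hmap hB1
            hφm hφ · z) ?_
          rw [hW, indicator_of_mem hz', boundaryWeight, if_neg hzN, mul_comm (φ z)]
          simpa using (hP.const_mul (2 * (1 - ‖B z‖ ^ 2) ^ 2)).add ((hJz h hzN).const_mul 2)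
  have hleft : Tendsto (fun i => ∫ ζ, φ ζ * (1 - ‖dilate b (ns i) ζ‖ ^ 2) ∂(sphereMeasure d)) atTop
      (𝓝 (∫ ζ, φ ζ * (1 - ‖B ζ‖ ^ 2) ∂(sphereMeasure d))) := by
    refine tendsto_integral_of_dominated_convergence (fun _ => 1) (fun i => ?_)
      (integrable_const _) (fun i => ae_of_all _ fun ζ => ?_) ?_
    · have := hm (ns i)
      exact Measurable.aestronglyMeasurable (by fun_prop)
    · have h1 := one_sub_norm_sq_mem_Icc (norm_dilate_le_one hmap (ns i) ζ)
      exact norm_le_one_of_mem_Icc ⟨mul_nonneg (hφ ζ).1 h1.1, mul_le_one₀ (hφ ζ).2 h1.1 h1.2⟩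
    · filter_upwards [hBσ, ae_sphereMeasure_norm_eq] with ζ hζ hζ1
      rcases hζ with ⟨h, -⟩ | ⟨-, h⟩
      · exact absurd hζ1 h.ne
      · exact ((((tendsto_dilate hζ1.le h).comp hns.tendsto_atTop).norm.pow 2).const_sub 1).const_mul _
  refine le_of_tendsto_of_tendsto' hleft (hlim.const_mul _) fun i => ?_
  refine (hA.integral_le hd hμ hb hmap hBm hB1 hB hφm hφ (ns i)).trans ?_
  have hIm := measurable_dilatedAverage hd hb.holomorphic.continuousOn hBm hφm (ns i)
  refine mul_le_mul_of_nonneg_left ?_ (by positivity)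
  refine integral_mono_ae ?_ ?_ (ae_of_all _ fun z => le_max_left _ _)
  · refine Integrable.of_bound hIm.aestronglyMeasurable 4 ?_
    filter_upwards [hμ] with z hz
    rw [Real.norm_of_nonneg (dilatedAverage_nonneg hφ _ z)]
    exact hI4 _ z hz
  · refine Integrable.of_bound (hIm.max hWm).aestronglyMeasurable 4 ?_
    filter_upwards [hμ] with z hz
    rw [Real.norm_of_nonneg (le_max_of_le_right (hW4 z).1)]
    exact max_le (hI4 _ z hz) (hW4 z).2

/-! ### From test functions to densities. -/

/-- Two finite measures are comparable if they are so on continuous functions into `[0, 1]`. -/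
theorem measure_le_of_forall_lintegral_continuous_le {X : Type*} [MeasurableSpace X]
    [PseudoEMetricSpace X] [BorelSpace X] {ν₁ ν₂ : Measure X} [IsFiniteMeasure ν₁]
    [IsFiniteMeasure ν₂]
    (h : ∀ φ : X → ℝ≥0, Continuous φ → (∀ x, φ x ≤ 1) → ∫⁻ x, φ x ∂ν₁ ≤ ∫⁻ x, φ x ∂ν₂) :
    ν₁ ≤ ν₂ := by
  have hF : ∀ F : Set X, IsClosed F → ν₁ F ≤ ν₂ F := by
    -- Thickened indicators of a closed set decrease to its indicator; inner regularity by closed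
    -- sets then handles Borel sets.
    intro F hF
    have hδ : ∀ n : ℕ, (0 : ℝ) < 1 / ((n : ℝ) + 1) := fun n => by positivity
    have hδ' : Tendsto (fun n : ℕ => 1 / ((n : ℝ) + 1)) atTop (𝓝 0) :=
      tendsto_one_div_add_atTop_nhds_zero_nat
    refine le_of_tendsto_of_tendsto' (tendsto_lintegral_thickenedIndicator_of_isClosed ν₁ hF hδ hδ')
      (tendsto_lintegral_thickenedIndicator_of_isClosed ν₂ hF hδ hδ') fun n => ?_
    exact h _ (thickenedIndicator (hδ n) F).continuous fun x => thickenedIndicator_le_one (hδ n) F x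
  refine Measure.le_iff.2 fun s hs => ?_
  rw [hs.measure_eq_iSup_isClosed_of_ne_top (measure_ne_top _ _)]
  exact iSup₂_le fun K hK => iSup_le fun hKc => (hF K hKc).trans (measure_mono hK)

theorem mainTheorem3 (d : ℕ) (hd : 1 ≤ d) (A : ℝ≥0) (hA : 0 < A) :
    ∃ C : ℝ, 0 < C ∧
      ∀ (b : CSpace d → ℂ) (μ : Measure (CSpace d)) [IsFiniteMeasure μ],
        μ (closedBall 0 1)ᶜ = 0 →
        MapsTo b (ball 0 1) (ball 0 1) →
        IsAdmissible μ b →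
        IsReverseCarlesonWith A b μ →
        ∀ᵐ ζ ∂(sphereMeasure d),
          (∃ l : ℂ, HasRadialLimit b ζ l) ∧
          1 - ‖boundaryExtension b ζ‖ ^ 2 ≤
            C * (1 - ‖boundaryExtension b ζ‖ ^ 2) ^ 2 *
              ((μ.restrict (sphere 0 1)).rnDeriv (sphereMeasure d) ζ).toReal := by
  -- `A²` comes from squaring the reverse Carleson inequality, `2` from `boundaryWeight` off `N`.
  refine ⟨2 * (A : ℝ) ^ 2, by positivity, ?_⟩
  intro b μ _ hsupp hmap hb hRC
  have := isProbabilityMeasure_sphereMeasure hd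
  have hμ : ∀ᵐ z ∂μ, ‖z‖ ≤ 1 := by
    have h : ∀ᵐ z ∂μ, z ∈ closedBall (0 : CSpace d) 1 := hsupp
    filter_upwards [h] with z hz
    exact mem_closedBall_zero_iff.1 hz
  -- The sum of the measures is used so that one Borel function serves as boundary value for both.
  obtain ⟨B, hBm, hB1, hBν⟩ := exists_measurable_boundaryValue hb.holomorphic hmap
    (μ + sphereMeasure d)
    (ae_add_measure_iff.2 ⟨hμ, ae_sphereMeasure_norm_eq.mono fun z hz => hz.le⟩)
    (ae_add_measure_iff.2 ⟨by
      have h := hb.radialLimit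
      rw [ae_restrict_iff' isClosed_sphere.measurableSet] at h
      filter_upwards [h] with z hz h1
      exact hz (mem_sphere_zero_iff_norm.2 h1),
      (ae_exists_hasRadialLimit hd hb.holomorphic hmap).mono fun z hz _ => hz⟩)
  obtain ⟨hB, hBσ⟩ := ae_add_measure_iff.1 hBν
  set σ := sphereMeasure d with hσ
  set μS := μ.restrict (sphere 0 1) with hμS
  have hfin : IsFiniteMeasure μS := inferInstanceAs (IsFiniteMeasure (μ.restrict (sphere 0 1)))
  have hprob : IsProbabilityMeasure σ := this
  have hsf : SFinite μS := @instSFiniteOfSigmaFinite _ _ _ (IsFiniteMeasure.toSigmaFinite μS)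
  have hsf' : SigmaFinite σ := IsFiniteMeasure.toSigmaFinite σ
  have hdec := μS.haveLebesgueDecomposition_add σ
  have hsing := Measure.mutuallySingular_singularPart μS σ
  -- `N` is σ-null and carries the singular part of `μ` on the sphere; off `N`, `μ` on the sphere is
  -- its density times `σ`.
  set N := hsing.nullSetᶜ with hNdef
  have hN : MeasurableSet N := hsing.measurableSet_nullSet.compl
  have hσN : σ N = 0 := hsing.measure_compl_nullSet
  have hNc : ∀ s, s ⊆ Nᶜ → μS.restrict s = (σ.withDensity (μS.rnDeriv σ)).restrict s := by
    intro s hs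
    conv_lhs => rw [hdec]
    rw [Measure.restrict_add, Measure.restrict_eq_zero.2, zero_add]
    refine measure_mono_null hs ?_
    rw [hNdef, compl_compl]
    exact hsing.measure_nullSet
  have hac : μS.restrict Nᶜ ≪ σ := by
    rw [hNc _ subset_rfl]
    exact Measure.restrict_le_self.absolutelyContinuous.trans (withDensity_absolutelyContinuous _ _)
  set p : CSpace d → ℝ := fun z => 1 - ‖B z‖ ^ 2 with hp
  have hpm : Measurable p := by fun_prop
  have hp01 : ∀ z, p z ∈ Icc (0 : ℝ) 1 := fun z => one_sub_norm_sq_mem_Icc (hB1 z)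
  set w := boundaryWeight B N with hw
  have hwm : Measurable w := measurable_boundaryWeight hBm hN
  have hw4 : ∀ z, w z ∈ Icc (0 : ℝ) 4 := boundaryWeight_mem hB1 N
  have hle : σ.withDensity (fun z => ENNReal.ofReal (p z)) ≤
      μS.withDensity fun z => ENNReal.ofReal ((A : ℝ) ^ 2 * w z) := by
    have f1 : IsFiniteMeasure (σ.withDensity fun z => ENNReal.ofReal (p z)) :=
      isFiniteMeasure_withDensity_ofReal (Integrable.of_bound hpm.aestronglyMeasurable 1
        (ae_of_all _ fun z => norm_le_one_of_mem_Icc (hp01 z))).2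
    have hwi : ∀ F : CSpace d → ℝ, Measurable F → (∀ z, F z ∈ Icc (0 : ℝ) 1) →
        Integrable (fun z => F z * w z) μS := fun F hF hF1 =>
      Integrable.of_bound (hF.mul hwm).aestronglyMeasurable 4 (ae_of_all _ fun z => by
        rw [Real.norm_of_nonneg (mul_nonneg (hF1 z).1 (hw4 z).1)]
        exact (mul_le_of_le_one_left (hw4 z).1 (hF1 z).2).trans (hw4 z).2)
    have f2 : IsFiniteMeasure (μS.withDensity fun z => ENNReal.ofReal ((A : ℝ) ^ 2 * w z)) := by
      refine isFiniteMeasure_withDensity_ofReal (Integrable.const_mul ?_ _).2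
      simpa using hwi (fun _ => 1) measurable_const fun _ => by norm_num
    refine measure_le_of_forall_lintegral_continuous_le fun φ hφc hφ1 => ?_
    have hφ : ∀ z, (φ z : ℝ) ∈ Icc (0 : ℝ) 1 := fun z => ⟨(φ z).2, by exact_mod_cast hφ1 z⟩
    have hφm := hφc.measurable
    have key := hRC.integral_le_boundaryWeight hd hμ hb hmap hBm hB1 hB hBσ hN hac
      (φ := fun z => (φ z : ℝ)) (by fun_prop) hφ
    rw [← integral_const_mul] at key
    have key2 := ENNReal.ofReal_le_ofReal key
    rw [ofReal_integral_eq_lintegral_ofReal, ofReal_integral_eq_lintegral_ofReal] at key2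
    · rw [lintegral_withDensity_eq_lintegral_mul _ hpm.ennreal_ofReal (by fun_prop),
        lintegral_withDensity_eq_lintegral_mul _ (by fun_prop) (by fun_prop)]
      convert key2 using 2
      · ext z
        rw [Pi.mul_apply, ENNReal.ofReal_mul (hφ z).1, ENNReal.ofReal_coe_nnreal, mul_comm]
      · ext z
        rw [Pi.mul_apply, mul_left_comm, ENNReal.ofReal_mul (hφ z).1, ENNReal.ofReal_coe_nnreal,
          mul_comm]
    · exact (hwi _ (by fun_prop) hφ).const_mul _
    · exact ae_of_all _ fun z => mul_nonneg (by positivity) (mul_nonneg (hφ z).1 (hw4 z).1)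
    · refine Integrable.of_bound (Measurable.aestronglyMeasurable (by fun_prop)) 1
        (ae_of_all _ fun z => norm_le_one_of_mem_Icc ?_)
      exact ⟨mul_nonneg (hφ z).1 (hp01 z).1, mul_le_one₀ (hφ z).2 (hp01 z).1 (hp01 z).2⟩
    · exact ae_of_all _ fun z => mul_nonneg (hφ z).1 (hp01 z).1
  have hae : (fun z => ENNReal.ofReal (p z)) ≤ᵐ[σ]
      fun z => μS.rnDeriv σ z * ENNReal.ofReal ((A : ℝ) ^ 2 * (2 * p z ^ 2)) := by
    -- Compare on `s \ N`: the left side does not change because `N` is σ-null, while on the right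
    -- the weight becomes `2 p²` and the singular part disappears.
    refine ae_le_of_forall_setLIntegral_le_of_sigmaFinite hpm.ennreal_ofReal fun s hs _ => ?_
    have h1 : ∫⁻ z in s, ENNReal.ofReal (p z) ∂σ = ∫⁻ z in s \ N, ENNReal.ofReal (p z) ∂σ :=
      setLIntegral_congr (sdiff_null_ae_eq_self hσN).symm
    have hsN : MeasurableSet (s \ N) := hs.diff hN
    have h2 := hle (s \ N)
    rw [withDensity_apply _ hsN, withDensity_apply _ hsN] at h2
    rw [h1]
    refine h2.trans ?_
    have h3 : ∫⁻ z in s \ N, ENNReal.ofReal ((A : ℝ) ^ 2 * w z) ∂μS =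
        ∫⁻ z in s \ N, ENNReal.ofReal ((A : ℝ) ^ 2 * (2 * p z ^ 2)) ∂μS := by
      refine setLIntegral_congr_fun hsN fun z hz => ?_
      simp only [hw, boundaryWeight, if_neg hz.2, hp]
    rw [h3, hNc _ fun z hz => hz.2, restrict_withDensity hsN,
      lintegral_withDensity_eq_lintegral_mul _ (Measure.measurable_rnDeriv _ _) (by fun_prop)]
    exact lintegral_mono_set sdiff_subset
  filter_upwards [hae, hBσ, ae_sphereMeasure_norm_eq, Measure.rnDeriv_lt_top μS σ] with ζ h1 h2 h3 h4
  rcases h2 with ⟨h, -⟩ | ⟨-, h⟩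
  · exact absurd h3 h.ne
  · refine ⟨⟨_, h⟩, ?_⟩
    rw [h.boundaryExtension_eq h3]
    have h5 := ENNReal.toReal_mono (ENNReal.mul_ne_top h4.ne ENNReal.ofReal_ne_top) h1
    rw [ENNReal.toReal_ofReal (hp01 ζ).1, ENNReal.toReal_mul, ENNReal.toReal_ofReal (by positivity)]
      at h5
    simp only [hp] at h5
    linarith
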